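/- Let $a,b,n\ge 1$ be integers and put $N=n(a+b)$. Let $S\subseteq[N]=\{1,\dots,N\}$ be the set whose indicator vector is $(0^a,1^b,0^a,1^b,\dots,0^a,1^b)$, with the block $(0^a,1^b)$ repeated $n$ times. The $(a,b)$-Catalan matroid $C_n^{a,b}$ is the matroid on $[N]$ whose bases are the sets $T\subseteq[N]$ with $|T|=|S|=nb$ such that, for every $1\le i\le nb$, the $i$-th smallest element of $T$ is at most the $i$-th smallest element of $S$. Let $U_{nb,N}$ be the uniform matroid on $[N]$ whose bases are all $nb$-element subsets. For a matroid $M$ on $[N]$ let $\mathcal P(M)=\operatorname{conv}\{e_B : B \text{ a basis of } M\}\subset\mathbb R^N$, where $e_B=\sum_{i\in B}e_i$; thus $\mathcal P(U_{nb,N})$ is a hypersimplex. Let $\operatorname{vol}$ denote the volume of such a polytope in its affine span, normalized so that a fundamental parallelepiped of the lattice of integer vectors parallel to that span has volume $1$. Let $A(m,k)$ be the Eulerian number, that is, the number of permutations of $[m]$ with exactly $k-1$ descents. Then $$\operatorname{vol}\bigl(\mathcal P(C_n^{a,b})\bigr)=\frac{1}{n\,(n(a+b)-1)!}\,A\bigl(n(a+b)-1,\,nb\bigr)\qquad\text{and}\qquad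 \operatorname{vol}\bigl(\mathcal P(C_n^{a,b})\bigr)=\frac1n\operatorname{vol}\bigl(\mathcal P(U_{nb,\,n(a+b)})\bigr).$$ -/

import Mathlib

/-! ### Schubert, Catalan and uniform matroids on `Fin N`

The ground set `[N] = {1, …, N}` is modelled by `Fin N`, so the element `i` of `[N]` becomes `i - 1`. -/

/-- `T ≤ S`: the sets have the same size and, for every `i`, the `i`-th smallest element of `T`
is at most the `i`-th smallest element of `S`. -/
def GaleLE {N : ℕ} (T S : Finset (Fin N)) : Prop :=
  ∃ h : T.card = S.card, ∀ i : Fin S.card, T.orderEmbOfFin h i ≤ S.orderEmbOfFin rfl i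

theorem GaleLE.refl {N : ℕ} (S : Finset (Fin N)) : GaleLE S S :=
  ⟨rfl, fun _ => le_rfl⟩

theorem card_filter_le_eq {N k : ℕ} (T : Finset (Fin N)) (h : T.card = k) (m : Fin N) :
    (T.filter (· ≤ m)).card
      = ((Finset.univ : Finset (Fin k)).filter (fun i => T.orderEmbOfFin h i ≤ m)).card := by
  conv_lhs => rw [← Finset.map_orderEmbOfFin_univ T h, Finset.filter_map, Finset.card_map]
  rfl

/-- The order `T ≤ S` in terms of the sizes of the initial parts of `T` and `S`. -/
theorem galeLE_iff {N : ℕ} (T S : Finset (Fin N)) :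
    GaleLE T S ↔ T.card = S.card ∧
      ∀ m : Fin N, (S.filter (· ≤ m)).card ≤ (T.filter (· ≤ m)).card := by
  constructor
  · rintro ⟨h, hle⟩
    refine ⟨h, fun m => ?_⟩
    rw [card_filter_le_eq S rfl m, card_filter_le_eq T h m]
    apply Finset.card_le_card
    intro i hi
    simp only [Finset.mem_filter, Finset.mem_univ, true_and] at hi ⊢
    exact (hle i).trans hi
  · rintro ⟨h, hc⟩
    refine ⟨h, fun i => ?_⟩
    by_contra! hlt
    have := hc (S.orderEmbOfFin rfl i)
    rw [card_filter_le_eq S rfl, card_filter_le_eq T h] at this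
    have h1 : ((Finset.univ : Finset (Fin S.card)).filter
        (fun j => T.orderEmbOfFin h j ≤ S.orderEmbOfFin rfl i)) ⊆ Finset.Iio i := by
      intro j hj
      simp only [Finset.mem_filter, Finset.mem_univ, true_and, Finset.mem_Iio] at hj ⊢
      exact (T.orderEmbOfFin h).lt_iff_lt.1 (hj.trans_lt hlt)
    have h2 : Finset.Iic i ⊆ ((Finset.univ : Finset (Fin S.card)).filter
        (fun j => S.orderEmbOfFin rfl j ≤ S.orderEmbOfFin rfl i)) := by
      intro j hj
      simp only [Finset.mem_filter, Finset.mem_univ, true_and, Finset.mem_Iic] at hj ⊢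
      exact (S.orderEmbOfFin rfl).monotone hj
    have h3 := Finset.card_le_card h1
    have h4 := Finset.card_le_card h2
    rw [Fin.card_Iio] at h3
    rw [Fin.card_Iic] at h4
    omega

theorem card_filter_exchange {N : ℕ} (A : Finset (Fin N)) {e f : Fin N} (he : e ∈ A) (hf : f ∉ A)
    (m : Fin N) :
    ((insert f (A.erase e)).filter (· ≤ m)).card + (if e ≤ m then 1 else 0)
      = (A.filter (· ≤ m)).card + (if f ≤ m then 1 else 0) := by
  have h1 : ((A.erase e).filter (· ≤ m)).card + (if e ≤ m then 1 else 0)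
      = (A.filter (· ≤ m)).card := by
    rw [Finset.filter_erase]
    split_ifs with h
    · exact Finset.card_erase_add_one (by simp [he, h])
    · rw [Finset.erase_eq_of_notMem (by simp [h])]; rfl
  have h2 : ((insert f (A.erase e)).filter (· ≤ m)).card
      = ((A.erase e).filter (· ≤ m)).card + (if f ≤ m then 1 else 0) := by
    rw [Finset.filter_insert]
    split_ifs with h
    · exact Finset.card_insert_of_notMem (by simp [hf])
    · rfl
  omega

theorem galeLE_exchange {N : ℕ} {S A B : Finset (Fin N)} (hA : GaleLE A S) (hB : GaleLE B S)
    {e : Fin N} (heA : e ∈ A) (heB : e ∉ B) :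
    ∃ f ∈ B, f ∉ A ∧ GaleLE (insert f (A.erase e)) S := by
  rw [galeLE_iff] at hA hB
  obtain ⟨hAc, hAl⟩ := hA
  obtain ⟨hBc, hBl⟩ := hB
  -- `f` is taken below every point `m ≥ e` at which the bound on `A` is attained
  obtain ⟨f, hfB, hfA, hf⟩ : ∃ f ∈ B, f ∉ A ∧ ∀ m : Fin N, e ≤ m →
      (A.filter (· ≤ m)).card = (S.filter (· ≤ m)).card → f ≤ m := by
    by_cases hex : ∃ m : Fin N, e ≤ m ∧ (A.filter (· ≤ m)).card = (S.filter (· ≤ m)).card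
    · obtain ⟨m, ⟨hem, hm⟩, hmin⟩ := WellFounded.has_min (wellFounded_lt (α := Fin N))
        {m : Fin N | e ≤ m ∧ (A.filter (· ≤ m)).card = (S.filter (· ≤ m)).card} hex
      have hnot : ¬ B.filter (· ≤ m) ⊆ (A.filter (· ≤ m)).erase e := by
        intro hsub
        have h1 := Finset.card_le_card hsub
        have h2 : e ∈ A.filter (· ≤ m) := by simp [heA, hem]
        have h3 := Finset.card_erase_add_one h2
        have h4 := hBl m
        omega
      obtain ⟨f, hf1, hf2⟩ := Finset.not_subset.1 hnot
      simp only [Finset.mem_filter] at hf1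
      refine ⟨f, hf1.1, fun hfA => hf2 ?_, fun m' h1 h2 => ?_⟩
      · refine Finset.mem_erase.2 ⟨?_, by simp [hfA, hf1.2]⟩
        rintro rfl
        exact heB hf1.1
      · exact hf1.2.trans (not_lt.1 (hmin m' ⟨h1, h2⟩))
    · have hnot : ¬ B ⊆ A.erase e := by
        intro hsub
        have h1 := Finset.card_le_card hsub
        have h3 := Finset.card_erase_add_one heA
        omega
      obtain ⟨f, hf1, hf2⟩ := Finset.not_subset.1 hnot
      refine ⟨f, hf1, fun hfA => hf2 (Finset.mem_erase.2 ⟨?_, hfA⟩),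
        fun m' h1 h2 => (hex ⟨m', h1, h2⟩).elim⟩
      rintro rfl
      exact heB hf1
  refine ⟨f, hfB, hfA, ?_⟩
  rw [galeLE_iff]
  constructor
  · rw [Finset.card_insert_of_notMem (by simp [hfA]), Finset.card_erase_add_one heA, hAc]
  · intro m
    have h1 := card_filter_exchange A heA hfA m
    have h2 := hAl m
    have h3 := hf m
    by_cases hem : e ≤ m
    · by_cases hfm : f ≤ m
      · simp only [hem, hfm, if_true] at h1
        omega
      · have : (A.filter (· ≤ m)).card ≠ (S.filter (· ≤ m)).card := fun h => hfm (h3 hem h)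
        simp only [hem, hfm, if_true, if_false] at h1
        omega
    · simp only [hem, if_false] at h1
      omega

/-- The Schubert matroid on `Fin N` given by `S`: its bases are the sets `T ≤ S`. -/
def schubertMatroid {N : ℕ} (S : Finset (Fin N)) : Matroid (Fin N) :=
  Matroid.ofIsBaseOfFinite (E := Set.univ) Set.finite_univ
    (fun B => ∃ T : Finset (Fin N), (T : Set (Fin N)) = B ∧ GaleLE T S)
    ⟨S, S, rfl, GaleLE.refl S⟩
    (by
      rintro _ _ ⟨A, rfl, hA⟩ ⟨B, rfl, hB⟩ e he
      obtain ⟨f, hfB, hfA, h⟩ := galeLE_exchange hA hB (e := e)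
        (by simpa using he.1) (by simpa using he.2)
      exact ⟨f, ⟨by simpa using hfB, by simpa using hfA⟩, insert f (A.erase e), by simp, h⟩)
    (fun _ _ => Set.subset_univ _)

theorem schubertMatroid_isBase_iff {N : ℕ} (S : Finset (Fin N)) (B : Set (Fin N)) :
    (schubertMatroid S).IsBase B ↔ ∃ T : Finset (Fin N), (T : Set (Fin N)) = B ∧ GaleLE T S :=
  Iff.rfl

/-- The subset of `Fin (n * (a + b))` whose indicator vector is `(0^a, 1^b)` repeated `n` times. -/
def catalanSet (a b n : ℕ) : Finset (Fin (n * (a + b))) :=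
  Finset.univ.filter (fun i => a ≤ i.val % (a + b))

/-- The `(a, b)`-Catalan matroid `C_n^{a,b}`. -/
def catalanMatroid (a b n : ℕ) : Matroid (Fin (n * (a + b))) :=
  schubertMatroid (catalanSet a b n)

/-- The uniform matroid `U_{k,N}`: its bases are all `k`-element subsets of `Fin N`. -/
def uniformMatroid (k N : ℕ) (hk : k ≤ N) : Matroid (Fin N) :=
  Matroid.ofIsBaseOfFinite (E := Set.univ) Set.finite_univ
    (fun B => ∃ T : Finset (Fin N), (T : Set (Fin N)) = B ∧ T.card = k)
    (by
      obtain ⟨T, -, hT⟩ := Finset.exists_subset_card_eq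
        (s := (Finset.univ : Finset (Fin N))) (n := k) (by simpa using hk)
      exact ⟨T, T, rfl, hT⟩)
    (by
      rintro _ _ ⟨A, rfl, hA⟩ ⟨B, rfl, hB⟩ e he
      have heA : e ∈ A := by simpa using he.1
      have heB : e ∉ B := by simpa using he.2
      have hnot : ¬ B ⊆ A.erase e := by
        intro hsub
        have h1 := Finset.card_le_card hsub
        have h3 := Finset.card_erase_add_one heA
        omega
      obtain ⟨f, hfB, hf⟩ := Finset.not_subset.1 hnot
      have hfA : f ∉ A := fun h => hf (Finset.mem_erase.2 ⟨fun h' => heB (h' ▸ hfB), h⟩)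
      refine ⟨f, ⟨by simpa using hfB, by simpa using hfA⟩, insert f (A.erase e), by simp, ?_⟩
      rw [Finset.card_insert_of_notMem hf, Finset.card_erase_add_one heA, hA])
    (fun _ _ => Set.subset_univ _)

theorem uniformMatroid_isBase_iff {k N : ℕ} (hk : k ≤ N) (B : Set (Fin N)) :
    (uniformMatroid k N hk).IsBase B ↔
      ∃ T : Finset (Fin N), (T : Set (Fin N)) = B ∧ T.card = k :=
  Iff.rfl

/-- The base polytope of a matroid: the convex hull of the indicator vectors of its bases. -/
noncomputable def matroidPolytope {N : ℕ} (M : Matroid (Fin N)) : Set (Fin N → ℝ) :=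
  convexHull ℝ {x | ∃ B : Set (Fin N), M.IsBase B ∧ x = B.indicator 1}

/-! ### Volume relative to the integer lattice -/

/-- The integer vectors parallel to the affine span of `P`. -/
def directionLattice {N : ℕ} (P : Set (Fin N → ℝ)) : Submodule ℤ (Fin N → ℤ) where
  carrier := {z | (fun i => (z i : ℝ)) ∈ vectorSpan ℝ P}
  zero_mem' := by
    have : (fun i => (((0 : Fin N → ℤ) i : ℤ) : ℝ)) = 0 := by ext i; simp
    change (fun i => (((0 : Fin N → ℤ) i : ℤ) : ℝ)) ∈ vectorSpan ℝ P
    rw [this]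
    exact Submodule.zero_mem _
  add_mem' := by
    intro x y hx hy
    have : (fun i => (((x + y) i : ℤ) : ℝ))
        = (fun i => (x i : ℝ)) + (fun i => (y i : ℝ)) := by ext i; simp
    change (fun i => (((x + y) i : ℤ) : ℝ)) ∈ vectorSpan ℝ P
    rw [this]
    exact Submodule.add_mem _ hx hy
  smul_mem' := by
    intro c x hx
    have : (fun i => (((c • x) i : ℤ) : ℝ)) = (c : ℝ) • (fun i => (x i : ℝ)) := by ext i; simp
    change (fun i => (((c • x) i : ℤ) : ℝ)) ∈ vectorSpan ℝ P
    rw [this]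
    exact Submodule.smul_mem _ _ hx

/-- A `ℤ`-basis of the integer vectors parallel to the affine span of `P`. -/
noncomputable def directionBasis {N : ℕ} (P : Set (Fin N → ℝ)) :
    Module.Basis (Fin (Module.finrank ℤ (directionLattice P))) ℤ (directionLattice P) :=
  Module.finBasis ℤ (directionLattice P)

/-- The volume of a (rational) polytope `P` in its affine span, normalized so that a fundamental
parallelepiped of the lattice of integer vectors parallel to the span has volume `1`: the Lebesgue
measure of `P` in the coordinates given by an origin `p ∈ P` and a `ℤ`-basis of that lattice.
The measure depends neither on the basis nor on `p`, so the supremum over `p ∈ P` is the common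
value (and `0` if `P` is empty). -/
noncomputable def latticeVolume {N : ℕ} (P : Set (Fin N → ℝ)) : ENNReal :=
  ⨆ p ∈ P, MeasureTheory.volume
    {t : Fin (Module.finrank ℤ (directionLattice P)) → ℝ |
      p + ∑ j, t j • (fun i => (((directionBasis P j : Fin N → ℤ) i : ℤ) : ℝ)) ∈ P}

/-! ### Eulerian numbers -/

/-- The number of descents of a permutation `σ` of `Fin m`: positions `i` with `σ i > σ (i + 1)`. -/
def numDescents {m : ℕ} (σ : Equiv.Perm (Fin m)) : ℕ :=
  (Finset.univ.filter (fun i : Fin m => ∃ h : i.val + 1 < m, σ ⟨i.val + 1, h⟩ < σ i)).card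

/-- The Eulerian number `A(m, k)`: the number of permutations of an `m`-element ordered set with
exactly `k - 1` descents. -/
def eulerianNumber (m k : ℕ) : ℕ :=
  (Finset.univ.filter (fun σ : Equiv.Perm (Fin m) => numDescents σ + 1 = k)).card

/-! The proof compares the Catalan polytope with the hypersimplex by a continuous cycle lemma, and
computes the hypersimplex by Stanley's dissection.

Put `d = a + b`. For a point `x` of the hypersimplex let the excess `h j` be the sum of the first `j
* d` entries, continued periodically, minus `j * b`. The Catalan polytope is the part of the
hypersimplex where `h ≥ 0` (`matroidPolytope_catalanMatroid`). That these inequalities cut out the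
convex hull of the bases follows by rounding: flooring the prefix sums with a uniformly random shift
`θ` gives 0/1 vectors with average `x`, and integer lower bounds on prefix sums survive the
flooring.

On the hypersimplex `h` is `n`-periodic, and shifting `x` cyclically by `i` blocks puts it into the
Catalan polytope exactly when `h` is minimal at `i`. Hence `n` rotated copies of that polytope cover
the hypersimplex. Two copies meet only where `h` takes the same value at two places, which is a null
set. Permuting coordinates preserves the lattice volume, so each copy has `1 / n` of the total
(`volume_hypersimplex_eq_mul_volume_catalanRegion`).

Partial sums identify the integer vectors of sum zero with `ℤ^(N-1)`, so the normalized volume is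
Lebesgue measure in these coordinates. There the hypersimplex of sum `k` splits, up to a null set,
into translates of order simplices of volume `1 / (N-1)!`, one for each permutation with `k - 1`
descents (`volume_hypersimplex`). -/

/-! ### Periodic prefix sums. -/

/-- The sum of the first `m` entries of `x`, continued periodically. -/
noncomputable def prefixSum {N : ℕ} [NeZero N] (x : Fin N → ℝ) (m : ℕ) : ℝ :=
  ∑ i ∈ Finset.range m, x (Fin.ofNat N i)

theorem prefixSum_zero {N : ℕ} [NeZero N] (x : Fin N → ℝ) : prefixSum x 0 = 0 := by
  simp [prefixSum]

theorem prefixSum_succ {N : ℕ} [NeZero N] (x : Fin N → ℝ) (m : ℕ) :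
    prefixSum x (m + 1) = prefixSum x m + x (Fin.ofNat N m) :=
  Finset.sum_range_succ _ _

theorem prefixSum_eq_sum_filter {N : ℕ} [NeZero N] (x : Fin N → ℝ) {m : ℕ} (hm : m ≤ N) :
    prefixSum x m = ∑ i ∈ Finset.univ.filter (fun i : Fin N => i.val < m), x i := by
  refine Finset.sum_bij (fun i _ => Fin.ofNat N i) ?_ ?_ ?_ (fun _ _ => rfl)
  · intro i hi
    have : i < m := Finset.mem_range.1 hi
    simp [Nat.mod_eq_of_lt (this.trans_le hm), this]
  · intro i hi j hj h
    have hi : i < m := Finset.mem_range.1 hi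
    have hj : j < m := Finset.mem_range.1 hj
    have h := congrArg Fin.val h
    simpa [Nat.mod_eq_of_lt (hi.trans_le hm), Nat.mod_eq_of_lt (hj.trans_le hm)] using h
  · intro i hi
    refine ⟨i.val, by simpa using hi, ?_⟩
    ext
    simp

theorem prefixSum_card {N : ℕ} [NeZero N] (x : Fin N → ℝ) : prefixSum x N = ∑ i, x i := by
  rw [prefixSum_eq_sum_filter x le_rfl, Finset.filter_true_of_mem (fun i _ => i.isLt)]

theorem prefixSum_add_period {N : ℕ} [NeZero N] (x : Fin N → ℝ) (m : ℕ) :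
    prefixSum x (m + N) = prefixSum x m + ∑ i, x i := by
  rw [← prefixSum_card, prefixSum, add_comm m N, Finset.sum_range_add, add_comm]
  congr 1
  refine Finset.sum_congr rfl fun i _ => congrArg x ?_
  ext
  simp

theorem prefixSum_mono {N : ℕ} [NeZero N] {x : Fin N → ℝ} (hx : ∀ i, 0 ≤ x i) :
    Monotone (prefixSum x) :=
  monotone_nat_of_le_succ fun m => by
    rw [prefixSum_succ]
    linarith [hx (Fin.ofNat N m)]

theorem prefixSum_add_le {N : ℕ} [NeZero N] {x : Fin N → ℝ} (hx : ∀ i, x i ≤ 1) (m r : ℕ) :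
    prefixSum x (m + r) ≤ prefixSum x m + r := by
  induction r with
  | zero => simp
  | succ r ih =>
    rw [← add_assoc, prefixSum_succ]
    push_cast
    linarith [hx (Fin.ofNat N (m + r))]

theorem prefixSum_indicator {N : ℕ} [NeZero N] (T : Finset (Fin N)) {m : ℕ} (hm : m ≤ N) :
    prefixSum ((T : Set (Fin N)).indicator 1) m = (T.filter (fun i => i.val < m)).card := by
  rw [prefixSum_eq_sum_filter _ hm]
  simp only [Set.indicator_apply, Finset.mem_coe, Pi.one_apply]
  rw [Finset.sum_ite_mem, Finset.sum_const, nsmul_eq_mul, mul_one, Finset.filter_inter,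
    Finset.univ_inter]

/-! ### Randomized rounding of prefix sums. -/

/-- The integral of `Int.fract` over a unit interval does not depend on where it starts; compare the
intervals starting at `s` and at `0`. -/
theorem integral_floor_add (s : ℝ) : ∫ θ in (0 : ℝ)..1, (⌊s + θ⌋ : ℝ) = s := by
  have hp : Function.Periodic (Int.fract : ℝ → ℝ) 1 := fun x => by simp
  have h1 : ∫ θ in (0 : ℝ)..1, (⌊s + θ⌋ : ℝ) = ∫ u in s..(s + 1), (⌊u⌋ : ℝ) := by
    simpa using intervalIntegral.integral_comp_add_left (fun u => (⌊u⌋ : ℝ)) s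
      (a := 0) (b := 1)
  have hmono : Monotone (fun u : ℝ => (⌊u⌋ : ℝ)) := fun u v h =>
    Int.cast_le.2 (Int.floor_mono h)
  have hid (p q : ℝ) : IntervalIntegrable (fun u : ℝ => u) MeasureTheory.volume p q :=
    continuous_id.intervalIntegrable _ _
  have hfl (p q : ℝ) : IntervalIntegrable (fun u : ℝ => (⌊u⌋ : ℝ)) MeasureTheory.volume p q :=
    hmono.intervalIntegrable
  have h2 (p q : ℝ) : ∫ u in p..q, Int.fract u = (∫ u in p..q, u) - ∫ u in p..q, (⌊u⌋ : ℝ) := by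
    rw [← intervalIntegral.integral_sub (hid p q) (hfl p q)]
    rfl
  have h3 := hp.intervalIntegral_add_eq s 0
  rw [h2, h2, integral_id, integral_id, zero_add] at h3
  have h4 : ∫ u in (0 : ℝ)..1, (⌊u⌋ : ℝ) = 0 := by
    rw [intervalIntegral.integral_of_le zero_le_one,
      ← MeasureTheory.integral_Ico_eq_integral_Ioc]
    refine MeasureTheory.setIntegral_eq_zero_of_forall_eq_zero fun u hu => ?_
    simp [Int.floor_eq_zero_iff.2 hu]
  rw [h1]
  rw [h4] at h3
  linarith [h3]

/-- The difference vector of the rounded prefix sums of `x`. -/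
noncomputable def roundedVector {N : ℕ} [NeZero N] (x : Fin N → ℝ) (θ : ℝ) : Fin N → ℝ :=
  fun i => (⌊prefixSum x (i.val + 1) + θ⌋ : ℝ) - (⌊prefixSum x i.val + θ⌋ : ℝ)

/-- By `integral_floor_add`, `x` is the mean of its roundings over `θ` in `(0, 1]`; a closed convex
set contains the mean of its points. -/
theorem mem_convexHull_of_roundedVector_mem {N : ℕ} [NeZero N] (x : Fin N → ℝ)
    {A : Set (Fin N → ℝ)} (hA : A.Finite) (h : ∀ θ, roundedVector x θ ∈ A) :
    x ∈ convexHull ℝ A := by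
  have hmono (s : ℝ) : Monotone (fun θ : ℝ => (⌊s + θ⌋ : ℝ)) := fun u v h =>
    Int.cast_le.2 (Int.floor_mono (by linarith))
  have hii (s : ℝ) : IntervalIntegrable (fun θ : ℝ => (⌊s + θ⌋ : ℝ)) MeasureTheory.volume 0 1 :=
    (hmono s).intervalIntegrable
  have hint (s : ℝ) : MeasureTheory.Integrable (fun θ : ℝ => (⌊s + θ⌋ : ℝ))
      (MeasureTheory.volume.restrict (Set.Ioc 0 1)) :=
    (intervalIntegrable_iff_integrableOn_Ioc_of_le zero_le_one).1 (hii s)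
  have hcoord (i : Fin N) : MeasureTheory.Integrable (fun θ => roundedVector x θ i)
      (MeasureTheory.volume.restrict (Set.Ioc 0 1)) := (hint _).sub (hint _)
  have : MeasureTheory.IsProbabilityMeasure
      (MeasureTheory.volume.restrict (Set.Ioc (0 : ℝ) 1)) := ⟨by simp⟩
  have hx : x = ∫ θ in Set.Ioc (0 : ℝ) 1, roundedVector x θ := by
    ext i
    rw [MeasureTheory.eval_integral hcoord]
    unfold roundedVector
    rw [← intervalIntegral.integral_of_le zero_le_one,
      intervalIntegral.integral_sub (hii _) (hii _), integral_floor_add, integral_floor_add,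
      prefixSum_succ]
    simp
  rw [hx]
  exact (convex_convexHull ℝ A).integral_mem (hA.isClosed_convexHull ℝ)
    (Filter.Eventually.of_forall fun θ => subset_convexHull ℝ A (h θ))
    (MeasureTheory.Integrable.of_eval hcoord)

/-- Prefix sums grow by steps in `[0, 1]`, so their floors grow by 0 or 1. The second clause carries
integer bounds on prefix sums of `x` over to `T`. -/
theorem exists_roundedVector_eq_indicator {N : ℕ} [NeZero N] {x : Fin N → ℝ}
    (hx : ∀ i, x i ∈ Set.Icc (0 : ℝ) 1) (θ : ℝ) :
    ∃ T : Finset (Fin N), roundedVector x θ = (T : Set (Fin N)).indicator 1 ∧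
      ∀ m ≤ N, ((T.filter (fun i => i.val < m)).card : ℤ) = ⌊prefixSum x m + θ⌋ - ⌊θ⌋ := by
  have h01 (i : Fin N) : ⌊prefixSum x (i.val + 1) + θ⌋ = ⌊prefixSum x i.val + θ⌋ ∨
      ⌊prefixSum x (i.val + 1) + θ⌋ = ⌊prefixSum x i.val + θ⌋ + 1 := by
    have h := hx (Fin.ofNat N i.val)
    have h1 : ⌊prefixSum x i.val + θ⌋ ≤ ⌊prefixSum x (i.val + 1) + θ⌋ :=
      Int.floor_mono (by rw [prefixSum_succ]; linarith [h.1])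
    have h2 : ⌊prefixSum x (i.val + 1) + θ⌋ ≤ ⌊prefixSum x i.val + θ⌋ + 1 := by
      rw [← Int.floor_add_one]
      exact Int.floor_mono (by rw [prefixSum_succ]; linarith [h.2])
    omega
  have hT : roundedVector x θ = ((Finset.univ.filter fun i : Fin N =>
      ⌊prefixSum x (i.val + 1) + θ⌋ = ⌊prefixSum x i.val + θ⌋ + 1 : Finset (Fin N)) :
        Set (Fin N)).indicator 1 := by
    ext i
    simp only [roundedVector, Set.indicator_apply, Finset.coe_filter, Finset.mem_univ, true_and,
      Set.mem_ofPred_eq, Pi.one_apply]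
    rcases h01 i with h | h
    · simp [h]
    · simp [h]
  refine ⟨_, hT, fun m hm => ?_⟩
  have h := (congrArg (prefixSum · m) hT).trans (prefixSum_indicator _ hm)
  have htel : prefixSum (roundedVector x θ) m = (⌊prefixSum x m + θ⌋ : ℝ) - ⌊θ⌋ := by
    clear h
    induction m with
    | zero => simp [prefixSum_zero]
    | succ m ih =>
      rw [prefixSum_succ, ih (by omega)]
      simp only [roundedVector, Fin.ofNat, Nat.mod_eq_of_lt (show m < N by omega)]
      ring
  exact_mod_cast h.symm.trans htel

/-! ### Inequality descriptions of the base polytopes. -/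

/-- The `k`-th hypersimplex in `ℝ^N`. -/
def hypersimplex (N k : ℕ) : Set (Fin N → ℝ) :=
  {x | (∀ i, x i ∈ Set.Icc (0 : ℝ) 1) ∧ ∑ i, x i = k}

theorem convex_hypersimplex (N k : ℕ) : Convex ℝ (hypersimplex N k) := by
  have : hypersimplex N k = Set.pi Set.univ (fun _ => Set.Icc (0 : ℝ) 1) ∩
      {x | (∑ i, LinearMap.proj (R := ℝ) (φ := fun _ : Fin N => ℝ) i) x = (k : ℝ)} := by
    ext x
    simp only [hypersimplex, Set.mem_inter_iff, Set.mem_univ_pi, Set.mem_ofPred_eq,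
      LinearMap.sum_apply, LinearMap.proj_apply]
  rw [this]
  exact (convex_pi fun _ _ => convex_Icc 0 1).inter
    (convex_hyperplane (LinearMap.isLinear _) _)

theorem indicator_mem_hypersimplex {N k : ℕ} {T : Finset (Fin N)} (h : T.card = k) :
    (T : Set (Fin N)).indicator 1 ∈ hypersimplex N k := by
  refine ⟨fun i => ?_, ?_⟩
  · by_cases hi : i ∈ T <;> simp [hi]
  · simp [Set.indicator_apply, h]

theorem finite_indicators {N : ℕ} (p : Set (Fin N) → Prop) :
    {x : Fin N → ℝ | ∃ B : Set (Fin N), p B ∧ x = B.indicator 1}.Finite := by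
  refine (Set.finite_range (fun B : Set (Fin N) => (B.indicator 1 : Fin N → ℝ))).subset ?_
  rintro _ ⟨B, -, rfl⟩
  exact ⟨B, rfl⟩

theorem matroidPolytope_uniformMatroid {k N : ℕ} [NeZero N] (hk : k ≤ N) :
    matroidPolytope (uniformMatroid k N hk) = hypersimplex N k := by
  apply subset_antisymm
  · refine convexHull_min ?_ (convex_hypersimplex N k)
    rintro _ ⟨_, ⟨T, rfl, hT⟩, rfl⟩
    exact indicator_mem_hypersimplex hT
  · rintro x ⟨hx, hs⟩
    refine mem_convexHull_of_roundedVector_mem x (finite_indicators _) fun θ => ?_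
    obtain ⟨T, hT, hc⟩ := exists_roundedVector_eq_indicator hx θ
    refine ⟨_, ⟨T, rfl, ?_⟩, hT⟩
    have := hc N le_rfl
    rw [Finset.filter_true_of_mem (fun i _ => i.isLt), prefixSum_card, hs,
      Int.floor_natCast_add] at this
    omega

theorem matroidPolytope_schubertMatroid {N : ℕ} [NeZero N] (S : Finset (Fin N)) :
    matroidPolytope (schubertMatroid S) = {x ∈ hypersimplex N S.card |
      ∀ m ≤ N, ((S.filter (fun i => i.val < m)).card : ℝ) ≤ prefixSum x m} := by
  have hconv : Convex ℝ {x ∈ hypersimplex N S.card |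
      ∀ m ≤ N, ((S.filter (fun i => i.val < m)).card : ℝ) ≤ prefixSum x m} := by
    intro x hx y hy s t hs ht hst
    refine ⟨convex_hypersimplex _ _ hx.1 hy.1 hs ht hst, fun m hm => ?_⟩
    have h : prefixSum (s • x + t • y) m = s * prefixSum x m + t * prefixSum y m := by
      simp [prefixSum, Finset.sum_add_distrib, Finset.mul_sum]
    rw [h]
    calc ((S.filter (fun i => i.val < m)).card : ℝ)
        = s * (S.filter (fun i => i.val < m)).card + t * (S.filter (fun i => i.val < m)).card := by
          rw [← add_mul, hst, one_mul]
      _ ≤ _ := add_le_add (mul_le_mul_of_nonneg_left (hx.2 m hm) hs)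
          (mul_le_mul_of_nonneg_left (hy.2 m hm) ht)
  have hfil (A : Finset (Fin N)) (m : Fin N) :
      A.filter (· ≤ m) = A.filter (fun i => i.val < m.val + 1) := by
    ext i
    simp only [Finset.mem_filter, Fin.le_def, Nat.lt_succ_iff]
  apply subset_antisymm
  · refine convexHull_min ?_ hconv
    rintro _ ⟨_, ⟨T, rfl, hT⟩, rfl⟩
    rw [galeLE_iff] at hT
    refine ⟨indicator_mem_hypersimplex hT.1, fun m hm => ?_⟩
    rw [prefixSum_indicator _ hm]
    rcases m with _ | m
    · simp
    · have := hT.2 ⟨m, hm⟩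
      rw [hfil, hfil] at this
      exact_mod_cast this
  · rintro x ⟨⟨hx, hs⟩, hp⟩
    refine mem_convexHull_of_roundedVector_mem x (finite_indicators _) fun θ => ?_
    obtain ⟨T, hT, hc⟩ := exists_roundedVector_eq_indicator hx θ
    refine ⟨_, ⟨T, rfl, (galeLE_iff T S).2 ⟨?_, fun m => ?_⟩⟩, hT⟩
    · have := hc N le_rfl
      rw [Finset.filter_true_of_mem (fun i _ => i.isLt), prefixSum_card, hs,
        Int.floor_natCast_add] at this
      omega
    · rw [hfil, hfil]
      have h1 := hc (m.val + 1) m.isLt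
      have h2 : ⌊((S.filter (fun i => i.val < m.val + 1)).card : ℝ) + θ⌋
          ≤ ⌊prefixSum x (m.val + 1) + θ⌋ :=
        Int.floor_mono (by linarith [hp (m.val + 1) m.isLt])
      rw [Int.floor_natCast_add] at h2
      omega

/-- The truncation in `r - a` is intended: the first `a` places of a block contribute nothing. -/
theorem count_le_mod {a b : ℕ} (q r : ℕ) (hr : r ≤ a + b) :
    Nat.count (fun i => a ≤ i % (a + b)) (q * (a + b) + r) = q * b + (r - a) := by
  have h0 : ∀ r ≤ a + b, Nat.count (fun i => a ≤ i % (a + b)) r = r - a := by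
    intro r hr
    induction r with
    | zero => simp
    | succ r ih =>
      rw [Nat.count_succ, ih (by omega), Nat.mod_eq_of_lt (by omega)]
      split_ifs <;> omega
  induction q with
  | zero => simpa using h0 r hr
  | succ q ih =>
    rw [show (q + 1) * (a + b) + r = (a + b) + (q * (a + b) + r) by ring, Nat.count_add,
      h0 _ le_rfl]
    simp only [Nat.add_mod_left]
    rw [ih, add_mul]
    omega

theorem card_filter_catalanSet (a b n m : ℕ) (hm : m ≤ n * (a + b)) :
    ((catalanSet a b n).filter (fun i => i.val < m)).card
      = Nat.count (fun i => a ≤ i % (a + b)) m := by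
  rw [Nat.count_eq_card_filter_range]
  refine Finset.card_bij (fun i _ => i.val) ?_ (fun i _ j _ h => Fin.ext h) ?_
  · intro i hi
    simp only [catalanSet, Finset.mem_filter, Finset.mem_univ, true_and] at hi
    simp [hi]
  · intro i hi
    simp only [Finset.mem_filter, Finset.mem_range] at hi
    exact ⟨⟨i, hi.1.trans_le hm⟩, by simp [catalanSet, hi], rfl⟩

theorem card_catalanSet (a b n : ℕ) : (catalanSet a b n).card = n * b := by
  have h := card_filter_catalanSet a b n _ le_rfl
  rw [Finset.filter_true_of_mem (fun i _ => i.isLt)] at h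
  simpa [h] using count_le_mod (a := a) (b := b) n 0 (by omega)

/-- The points of the hypersimplex whose sums over the first `j` blocks of length `d` are at
least `j * b`. -/
def catalanRegion (N k d b : ℕ) [NeZero N] : Set (Fin N → ℝ) :=
  {x ∈ hypersimplex N k | ∀ j : ℕ, (j * b : ℝ) ≤ prefixSum x (j * d)}

/-- A full period adds `n * b` to both terms. So the conditions of `catalanRegion`, imposed for all
`j`, amount to those for `j < n`. -/
theorem prefixSum_block_period {N n d b : ℕ} [NeZero N] (hN : N = n * d) {x : Fin N → ℝ}
    (hx : ∑ i, x i = (n * b : ℕ)) (j q : ℕ) :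
    prefixSum x ((j + q * n) * d) - ((j + q * n : ℕ) * b : ℝ) = prefixSum x (j * d) - j * b := by
  induction q with
  | zero => simp
  | succ q ih =>
    rw [show (j + (q + 1) * n) * d = (j + q * n) * d + N by rw [hN]; ring,
      prefixSum_add_period, hx, ← ih]
    push_cast
    ring

/-- The inequalities inside a block follow from those at its ends. Along the zeros the bound is
constant and prefix sums do not decrease; along the ones the bound has slope 1 and prefix sums grow
by at most 1 per step, so the bound at the end of the block propagates backwards. -/
theorem matroidPolytope_catalanMatroid {a b n : ℕ} [NeZero (n * (a + b))] :
    matroidPolytope (catalanMatroid a b n)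
      = catalanRegion (n * (a + b)) (n * b) (a + b) b := by
  have hN : 0 < n * (a + b) := NeZero.pos _
  have hn : 0 < n := Nat.pos_of_mul_pos_right hN
  have hd : 0 < a + b := Nat.pos_of_mul_pos_left hN
  rw [catalanMatroid, matroidPolytope_schubertMatroid, card_catalanSet]
  ext x
  refine and_congr_right fun hx => ⟨fun h j => ?_, fun h m hm => ?_⟩
  · have h1 := prefixSum_block_period rfl hx.2 (j % n) (j / n)
    rw [mul_comm (j / n) n, Nat.mod_add_div] at h1
    have h2 : j % n * (a + b) ≤ n * (a + b) := Nat.mul_le_mul_right _ (Nat.mod_lt _ hn).le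
    have h3 := h _ h2
    have h4 := count_le_mod (a := a) (b := b) (j % n) 0 (by omega)
    rw [card_filter_catalanSet _ _ _ _ h2] at h3
    simp only [add_zero, Nat.zero_sub] at h4
    rw [h4] at h3
    push_cast at h3
    linarith
  · rw [card_filter_catalanSet _ _ _ _ hm]
    obtain ⟨q, r, hr, rfl⟩ : ∃ q r, r < a + b ∧ m = q * (a + b) + r :=
      ⟨m / (a + b), m % (a + b), Nat.mod_lt _ hd, (Nat.div_add_mod' _ _).symm⟩
    rw [count_le_mod _ _ hr.le]
    rcases le_total r a with hra | hra
    · rw [Nat.sub_eq_zero_of_le hra]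
      have h1 := prefixSum_mono (fun i => (hx.1 i).1) (Nat.le_add_right (q * (a + b)) r)
      have h2 := h q
      push_cast
      linarith
    · have h1 := prefixSum_add_le (fun i => (hx.1 i).2) (q * (a + b) + r) (a + b - r)
      rw [show q * (a + b) + r + (a + b - r) = (q + 1) * (a + b) by
        rw [add_mul]; omega] at h1
      have h2 := h (q + 1)
      push_cast [Nat.cast_sub hra, Nat.cast_sub hr.le] at h1 h2 ⊢
      linarith

/-! ### Partial-sum coordinates and the lattice volume. -/

/-- The vector of consecutive differences of `(0, s, 0)`. -/
def diffMap (R : Type*) [CommRing R] (M : ℕ) : (Fin M → R) →ₗ[R] (Fin (M + 1) → R) where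
  toFun s := Fin.snoc (α := fun _ => R) s 0 - Fin.cons (α := fun _ => R) 0 s
  map_add' s t := by
    ext i
    have h1 : Fin.snoc (α := fun _ => R) (s + t) 0 i
        = Fin.snoc (α := fun _ => R) s 0 i + Fin.snoc (α := fun _ => R) t 0 i := by
      refine Fin.lastCases ?_ (fun i => ?_) i <;> simp
    have h2 : Fin.cons (α := fun _ => R) 0 (s + t) i
        = Fin.cons (α := fun _ => R) 0 s i + Fin.cons (α := fun _ => R) 0 t i := by
      refine Fin.cases ?_ (fun i => ?_) i <;> simp
    simp only [Pi.sub_apply, Pi.add_apply, h1, h2]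
    ring
  map_smul' c s := by
    ext i
    have h1 : Fin.snoc (α := fun _ => R) (c • s) 0 i
        = c * Fin.snoc (α := fun _ => R) s 0 i := by
      refine Fin.lastCases ?_ (fun i => ?_) i <;> simp
    have h2 : Fin.cons (α := fun _ => R) 0 (c • s) i
        = c * Fin.cons (α := fun _ => R) 0 s i := by
      refine Fin.cases ?_ (fun i => ?_) i <;> simp
    simp only [Pi.sub_apply, Pi.smul_apply, h1, h2, smul_eq_mul, RingHom.id_apply]
    ring

theorem diffMap_apply {R : Type*} [CommRing R] {M : ℕ} (s : Fin M → R) (i : Fin (M + 1)) :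
    diffMap R M s i = Fin.snoc (α := fun _ => R) s 0 i - Fin.cons (α := fun _ => R) 0 s i :=
  rfl

theorem sum_diffMap {R : Type*} [CommRing R] {M : ℕ} (s : Fin M → R) :
    ∑ i, diffMap R M s i = 0 := by
  simp only [diffMap_apply, Finset.sum_sub_distrib]
  rw [Fin.sum_univ_castSucc, Fin.sum_univ_succ (fun i => Fin.cons (α := fun _ => R) 0 s i)]
  simp

theorem diffMap_injective {R : Type*} [CommRing R] {M : ℕ} :
    Function.Injective (diffMap R M) := by
  rw [injective_iff_map_eq_zero]
  intro s hs
  have h : ∀ m (hm : m < M), s ⟨m, hm⟩ = 0 := by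
    intro m
    induction m with
    | zero =>
      intro hm
      have := congrFun hs (Fin.castSucc ⟨0, hm⟩)
      have h0 : Fin.castSucc (⟨0, hm⟩ : Fin M) = 0 := rfl
      rw [diffMap_apply, Fin.snoc_castSucc, h0, Fin.cons_zero] at this
      simpa using this
    | succ m ih =>
      intro hm
      have := congrFun hs (Fin.castSucc ⟨m + 1, hm⟩)
      have h0 : Fin.castSucc (⟨m + 1, hm⟩ : Fin M) = Fin.succ ⟨m, by omega⟩ := rfl
      rw [diffMap_apply, Fin.snoc_castSucc, h0, Fin.cons_succ, ih] at this
      simpa using this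
  ext i
  exact h i.1 i.2

theorem exists_diffMap_eq {R : Type*} [CommRing R] {M : ℕ} (z : Fin (M + 1) → R)
    (hz : ∑ i, z i = 0) : ∃ s, diffMap R M s = z := by
  set S : ℕ → R := fun m => ∑ i ∈ Finset.univ.filter (fun i : Fin (M + 1) => i.val < m), z i
    with hS
  have hstep (i : Fin (M + 1)) : S (i.val + 1) = z i + S i.val := by
    have : Finset.univ.filter (fun j : Fin (M + 1) => j.val < i.val + 1)
        = insert i (Finset.univ.filter (fun j : Fin (M + 1) => j.val < i.val)) := by
      ext j
      simp only [Finset.mem_filter, Finset.mem_univ, true_and, Finset.mem_insert, Fin.ext_iff]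
      omega
    simp only [hS]
    rw [this, Finset.sum_insert (by simp)]
  refine ⟨fun j => S (j.val + 1), ?_⟩
  ext i
  have h1 : Fin.snoc (α := fun _ => R) (fun j : Fin M => S (j.val + 1)) 0 i = S (i.val + 1) := by
    refine Fin.lastCases ?_ (fun i => ?_) i
    · rw [Fin.snoc_last, ← hz]
      simp only [hS]
      rw [Finset.filter_true_of_mem (fun i _ => i.isLt)]
    · simp
  have h2 : Fin.cons (α := fun _ => R) 0 (fun j : Fin M => S (j.val + 1)) i = S i.val := by
    refine Fin.cases ?_ (fun i => ?_) i
    · simp [hS]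
    · simp
  rw [diffMap_apply, h1, h2, hstep]
  ring

theorem diffMap_intCast {M : ℕ} (s : Fin M → ℤ) (i : Fin (M + 1)) :
    ((diffMap ℤ M s i : ℤ) : ℝ) = diffMap ℝ M (fun j => (s j : ℝ)) i := by
  simp only [diffMap_apply, Int.cast_sub]
  congr 1
  · refine Fin.lastCases ?_ (fun i => ?_) i <;> simp
  · refine Fin.cases ?_ (fun i => ?_) i <;> simp

/-- The point of the hyperplane `∑ x i = k` with partial sums `s`. -/
noncomputable def hyperplaneMap {M : ℕ} (k : ℝ) (s : Fin M → ℝ) : Fin (M + 1) → ℝ :=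
  diffMap ℝ M s + Pi.single (Fin.last M) k

theorem sum_hyperplaneMap {M : ℕ} (k : ℝ) (s : Fin M → ℝ) : ∑ i, hyperplaneMap k s i = k := by
  simp [hyperplaneMap, Finset.sum_add_distrib, sum_diffMap]

theorem exists_hyperplaneMap_eq {M : ℕ} {k : ℝ} {x : Fin (M + 1) → ℝ} (hx : ∑ i, x i = k) :
    ∃ s, hyperplaneMap k s = x := by
  obtain ⟨s, hs⟩ := exists_diffMap_eq (x - Pi.single (Fin.last M) k)
    (by simp [Finset.sum_sub_distrib, hx])
  exact ⟨s, by rw [hyperplaneMap, hs, sub_add_cancel]⟩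

theorem continuous_hyperplaneMap {M : ℕ} (k : ℝ) :
    Continuous (hyperplaneMap k : (Fin M → ℝ) → (Fin (M + 1) → ℝ)) :=
  (LinearMap.continuous_of_finiteDimensional _).add continuous_const

/-- The coordinates of the vectors with sum zero given by partial sums after a permutation. -/
noncomputable def zeroSumEquiv {M : ℕ} (L : Submodule ℤ (Fin (M + 1) → ℤ))
    (hL : ∀ z, z ∈ L ↔ ∑ i, z i = 0) (σ : Equiv.Perm (Fin (M + 1))) :
    (Fin M → ℤ) ≃ₗ[ℤ] L :=
  LinearEquiv.ofBijective
    (((LinearMap.funLeft ℤ ℤ σ).comp (diffMap ℤ M)).codRestrict L (fun s => (hL _).2 (by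
      simpa using (Equiv.sum_comp σ (diffMap ℤ M s)).trans (sum_diffMap s))))
    ⟨fun s t h => diffMap_injective
        (LinearMap.funLeft_injective_of_surjective ℤ ℤ σ σ.surjective (congrArg Subtype.val h)),
      fun z => by
        obtain ⟨s, hs⟩ := exists_diffMap_eq (fun i => z.1 (σ.symm i))
          ((Equiv.sum_comp σ.symm z.1).trans ((hL _).1 z.2))
        refine ⟨s, Subtype.ext ?_⟩
        ext i
        simp [LinearMap.funLeft_apply, hs]⟩

theorem coe_zeroSumEquiv {M : ℕ} (L : Submodule ℤ (Fin (M + 1) → ℤ))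
    (hL : ∀ z, z ∈ L ↔ ∑ i, z i = 0) (σ : Equiv.Perm (Fin (M + 1))) (s : Fin M → ℤ)
    (i : Fin (M + 1)) : (zeroSumEquiv L hL σ s : Fin (M + 1) → ℤ) i = diffMap ℤ M s (σ i) :=
  rfl

/-- All `ℤ`-bases of the lattice of integer vectors with sum zero give the same volume. -/
theorem volume_latticeCoords {M r : ℕ} (L : Submodule ℤ (Fin (M + 1) → ℤ))
    (hL : ∀ z, z ∈ L ↔ ∑ i, z i = 0) (b : Module.Basis (Fin r) ℤ L) {p : Fin (M + 1) → ℝ} {k : ℝ}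
    (hp : ∑ i, p i = k) (P : Set (Fin (M + 1) → ℝ)) :
    MeasureTheory.volume {t : Fin r → ℝ |
      p + ∑ j, t j • (fun i => (((b j : Fin (M + 1) → ℤ) i : ℤ) : ℝ)) ∈ P}
      = MeasureTheory.volume (hyperplaneMap k ⁻¹' P) := by
  set e := zeroSumEquiv L hL 1
  obtain rfl : r = M := by
    have h := Module.finrank_eq_card_basis (b.map e.symm)
    simpa using h.symm
  -- The transition matrix is invertible over `ℤ`, so its determinant is `±1` and the change of
  -- coordinates preserves Lebesgue measure; `u` below accounts for the origin `p`.
  set A : Matrix (Fin r) (Fin r) ℤ := (Pi.basisFun ℤ (Fin r)).toMatrix (b.map e.symm) with hA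
  have hdet : IsUnit A.det := by
    have := (Pi.basisFun ℤ (Fin r)).invertibleToMatrix (b.map e.symm)
    exact (Matrix.isUnit_iff_isUnit_det _).1 (isUnit_of_invertible _)
  set AR : Matrix (Fin r) (Fin r) ℝ := A.map (Int.castRingHom ℝ) with hAR
  have hdetR : |AR.det| = 1 := by
    have h : AR.det = ((A.det : ℤ) : ℝ) := ((Int.castRingHom ℝ).map_det A).symm
    rw [h]
    rcases Int.isUnit_iff.1 hdet with h | h <;> rw [h] <;> simp
  have hlin : LinearMap.det (Matrix.toLin' AR) = AR.det := LinearMap.det_toLin' AR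
  obtain ⟨u, hu⟩ := exists_hyperplaneMap_eq hp
  have hb (j : Fin r) (i : Fin (r + 1)) : (((b j : Fin (r + 1) → ℤ) i : ℤ) : ℝ)
      = diffMap ℝ r (fun l => AR l j) i := by
    have h1 : (b j : Fin (r + 1) → ℤ) i = diffMap ℤ r (e.symm (b j)) i := by
      conv_lhs => rw [← e.apply_symm_apply (b j)]
      rfl
    rw [h1, diffMap_intCast]
    rfl
  have hset : {t : Fin r → ℝ |
      p + ∑ j, t j • (fun i => (((b j : Fin (r + 1) → ℤ) i : ℤ) : ℝ)) ∈ P}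
      = (Matrix.toLin' AR) ⁻¹' ((u + ·) ⁻¹' (hyperplaneMap k ⁻¹' P)) := by
    ext t
    have h : p + ∑ j, t j • (fun i => (((b j : Fin (r + 1) → ℤ) i : ℤ) : ℝ))
        = hyperplaneMap k (u + Matrix.toLin' AR t) := by
      have h2 : Matrix.toLin' AR t = ∑ j, t j • (fun l => AR l j) := by
        ext l
        simp [Matrix.mulVec, dotProduct, mul_comm]
      have h3 : ∑ j, t j • (fun i => (((b j : Fin (r + 1) → ℤ) i : ℤ) : ℝ))
          = diffMap ℝ r (Matrix.toLin' AR t) := by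
        rw [h2, map_sum]
        refine Finset.sum_congr rfl fun j _ => ?_
        rw [map_smul]
        congr 1
        ext i
        exact hb j i
      rw [h3, ← hu]
      simp only [hyperplaneMap, map_add]
      abel
    simp only [Set.mem_ofPred_eq, Set.mem_preimage, h]
  have hne : LinearMap.det (Matrix.toLin' AR) ≠ 0 := by
    rw [hlin]
    intro h0
    rw [h0] at hdetR
    simp at hdetR
  rw [hset, MeasureTheory.Measure.addHaar_preimage_linearMap _ hne, hlin, abs_inv, hdetR,
    MeasureTheory.measure_preimage_add]
  simp

/-- A coordinate permutation carries one `ℤ`-basis of the sum-zero lattice to another, and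
`volume_latticeCoords` makes the volume independent of the basis. -/
theorem volume_hyperplaneMap_preimage_comp {M : ℕ} (k : ℝ) (σ : Equiv.Perm (Fin (M + 1)))
    (P : Set (Fin (M + 1) → ℝ)) :
    MeasureTheory.volume (hyperplaneMap k ⁻¹' {x | x ∘ σ ∈ P})
      = MeasureTheory.volume (hyperplaneMap k ⁻¹' P) := by
  set L : Submodule ℤ (Fin (M + 1) → ℤ) :=
    LinearMap.ker (∑ i, LinearMap.proj (R := ℤ) (φ := fun _ : Fin (M + 1) => ℤ) i) with hLdef
  have hL : ∀ z, z ∈ L ↔ ∑ i, z i = 0 := fun z => by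
    rw [hLdef, LinearMap.mem_ker, LinearMap.sum_apply]
    rfl
  set b : Module.Basis (Fin M) ℤ L := Module.Basis.ofEquivFun (zeroSumEquiv L hL σ).symm
  have hp : ∑ i, ((Pi.single (Fin.last M) k : Fin (M + 1) → ℝ) ∘ σ) i = k := by
    exact (Equiv.sum_comp σ (Pi.single (Fin.last M) k : Fin (M + 1) → ℝ)).trans (by simp)
  rw [← volume_latticeCoords L hL b hp P]
  congr 1
  ext s
  simp only [Set.mem_preimage, Set.mem_ofPred_eq]
  have h : hyperplaneMap k s ∘ σ = (Pi.single (Fin.last M) k : Fin (M + 1) → ℝ) ∘ σ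
      + ∑ j, s j • (fun i => (((b j : Fin (M + 1) → ℤ) i : ℤ) : ℝ)) := by
    ext i
    have hb (j : Fin M) : (((b j : Fin (M + 1) → ℤ) i : ℤ) : ℝ)
        = diffMap ℝ M (Pi.single j 1) (σ i) := by
      have : (b j : Fin (M + 1) → ℤ) i = diffMap ℤ M (Pi.single j 1) (σ i) := by
        simp only [b, Module.Basis.coe_ofEquivFun, LinearEquiv.symm_symm]
        rw [coe_zeroSumEquiv]
      rw [this, diffMap_intCast]
      refine congrArg (fun f => diffMap ℝ M f (σ i)) ?_
      ext l
      by_cases hl : l = j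
      · subst hl; simp
      · simp [hl]
    have hs : diffMap ℝ M s (σ i) = ∑ j, s j * diffMap ℝ M (Pi.single j 1) (σ i) := by
      conv_lhs => rw [pi_eq_sum_univ' s, map_sum, Finset.sum_apply]
      refine Finset.sum_congr rfl fun j _ => ?_
      rw [map_smul]
      rfl
    simp only [Function.comp_apply, hyperplaneMap, Pi.add_apply, Finset.sum_apply, Pi.smul_apply,
      smul_eq_mul, hb, hs]
    ring
  rw [h]

/-- `P` contains a neighbourhood of `p` within the hyperplane, so `p + t • v` stays in `P` for some
`t ≠ 0`. This identifies `directionLattice P` with all integer vectors of sum zero. -/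
theorem mem_vectorSpan_iff_sum_eq_zero {N : ℕ} {P U : Set (Fin N → ℝ)} {k : ℝ}
    (hP : ∀ x ∈ P, ∑ i, x i = k) (hU : IsOpen U) (hUP : ∀ x ∈ U, ∑ i, x i = k → x ∈ P)
    {p : Fin N → ℝ} (hpU : p ∈ U) (hp : ∑ i, p i = k) (v : Fin N → ℝ) :
    v ∈ vectorSpan ℝ P ↔ ∑ i, v i = 0 := by
  constructor
  · intro hv
    have hle : vectorSpan ℝ P ≤
        LinearMap.ker (∑ i, LinearMap.proj (R := ℝ) (φ := fun _ : Fin N => ℝ) i) := by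
      refine Submodule.span_le.2 ?_
      rintro _ ⟨x, hx, y, hy, rfl⟩
      simp [LinearMap.mem_ker, hP x hx, hP y hy]
    have := hle hv
    rw [LinearMap.mem_ker, LinearMap.sum_apply] at this
    exact this
  · intro hv
    have hc : Continuous fun t : ℝ => p + t • v := by fun_prop
    have hmem : ∀ᶠ t in nhds (0 : ℝ), p + t • v ∈ U :=
      hc.continuousAt.eventually_mem (hU.mem_nhds (by simpa using hpU))
    obtain ⟨t, ht, ht0⟩ := ((hmem.filter_mono nhdsWithin_le_nhds).and
      (self_mem_nhdsWithin (a := (0 : ℝ)) (s := {0}ᶜ))).exists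
    have ht0 : t ≠ 0 := ht0
    have h1 : p + t • v ∈ P := hUP _ ht (by
      simp [Finset.sum_add_distrib, ← Finset.mul_sum, hp, hv])
    have h2 := vsub_mem_vectorSpan ℝ h1 (hUP p hpU hp)
    have h3 := Submodule.smul_mem (vectorSpan ℝ P) t⁻¹ h2
    simpa [smul_smul, inv_mul_cancel₀ ht0] using h3

theorem latticeVolume_eq_volume_hyperplaneMap {M : ℕ} {P : Set (Fin (M + 1) → ℝ)} {k : ℝ}
    (hne : P.Nonempty) (hP : ∀ x ∈ P, ∑ i, x i = k)
    (hspan : ∀ v, v ∈ vectorSpan ℝ P ↔ ∑ i, v i = 0) :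
    latticeVolume P = MeasureTheory.volume (hyperplaneMap k ⁻¹' P) := by
  have hL : ∀ z, z ∈ directionLattice P ↔ ∑ i, z i = 0 := fun z => by
    change (fun i => (z i : ℝ)) ∈ vectorSpan ℝ P ↔ _
    rw [hspan]
    exact_mod_cast Iff.rfl
  unfold latticeVolume
  rw [← biSup_const (a := MeasureTheory.volume (hyperplaneMap k ⁻¹' P)) hne]
  exact iSup_congr fun p => iSup_congr fun hp =>
    volume_latticeCoords _ hL (directionBasis P) (hP p hp) P

/-! ### Generic points and order simplices. -/

theorem volume_linear_eq_const {M : ℕ} {ℓ : (Fin M → ℝ) →ₗ[ℝ] ℝ} (hℓ : ℓ ≠ 0) (r : ℝ) :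
    MeasureTheory.volume {s | ℓ s = r} = 0 := by
  by_cases h : ∃ s₀, ℓ s₀ = r
  · obtain ⟨s₀, hs₀⟩ := h
    have h1 : {s | ℓ s = r} = (AffineSubspace.mk' s₀ (LinearMap.ker ℓ) : Set (Fin M → ℝ)) := by
      ext s
      simp [AffineSubspace.mem_mk', sub_eq_zero, hs₀]
    rw [h1]
    refine MeasureTheory.Measure.addHaar_affineSubspace _ _ fun htop => hℓ ?_
    have h2 := congrArg AffineSubspace.direction htop
    rw [AffineSubspace.direction_mk', AffineSubspace.direction_top] at h2
    exact LinearMap.ker_eq_top.1 h2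
  · rw [show {s | ℓ s = r} = ∅ from Set.eq_empty_of_forall_notMem fun s hs => h ⟨s, hs⟩]
    exact MeasureTheory.measure_empty

/-- The leading 0 lets single entries and differences of entries be treated alike, both for
genericity and for the overlaps of rotated regions. -/
theorem volume_cons_sub_cons_eq {M : ℕ} {i j : Fin (M + 1)} (hij : i ≠ j) (r : ℝ) :
    MeasureTheory.volume {s : Fin M → ℝ |
      Fin.cons (α := fun _ => ℝ) 0 s i - Fin.cons (α := fun _ => ℝ) 0 s j = r} = 0 := by
  set coord : Fin (M + 1) → ((Fin M → ℝ) →ₗ[ℝ] ℝ) :=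
    Fin.cons 0 (fun i => LinearMap.proj (R := ℝ) (φ := fun _ : Fin M => ℝ) i) with hcoord
  have hc (l : Fin (M + 1)) (s : Fin M → ℝ) : coord l s = Fin.cons (α := fun _ => ℝ) 0 s l := by
    refine Fin.cases ?_ (fun l => ?_) l <;> simp [hcoord]
  have hne : coord i - coord j ≠ 0 := by
    intro h
    -- On the test point `(1, 2, 3, …)` the coordinate of index `l` has value `l`, so distinct
    -- coordinates are distinct functionals.
    have h1 := LinearMap.congr_fun h (fun l : Fin M => (l.val + 1 : ℝ))
    have h2 (l : Fin (M + 1)) :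
        Fin.cons (α := fun _ => ℝ) 0 (fun l : Fin M => (l.val + 1 : ℝ)) l = (l.val : ℝ) := by
      refine Fin.cases ?_ (fun l => ?_) l <;> simp
    rw [LinearMap.sub_apply, hc, hc, h2, h2, LinearMap.zero_apply, sub_eq_zero] at h1
    exact hij (Fin.ext (by exact_mod_cast h1))
  simpa [hc] using volume_linear_eq_const hne r

/-- No two of the numbers `0, s 0, s 1, …` differ by an integer. -/
def IsGeneric {M : ℕ} (s : Fin M → ℝ) : Prop :=
  (∀ i (m : ℤ), s i ≠ m) ∧ ∀ i j, i ≠ j → ∀ m : ℤ, s i - s j ≠ m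

theorem ae_isGeneric (M : ℕ) : ∀ᵐ s : Fin M → ℝ, IsGeneric s := by
  refine Filter.Eventually.and ?_ ?_
  · refine MeasureTheory.ae_all_iff.2 fun i => MeasureTheory.ae_all_iff.2 fun m => ?_
    have := volume_cons_sub_cons_eq (Fin.succ_ne_zero i) (m : ℝ)
    simpa [MeasureTheory.ae_iff] using this
  · refine MeasureTheory.ae_all_iff.2 fun i => MeasureTheory.ae_all_iff.2 fun j => ?_
    by_cases hij : i = j
    · simp [hij]
    refine Filter.Eventually.mono (MeasureTheory.ae_all_iff.2 fun m : ℤ => ?_) fun _ h _ => h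
    have := volume_cons_sub_cons_eq (fun h => hij (Fin.succ_injective _ h)) (m : ℝ)
    simpa [MeasureTheory.ae_iff] using this

/-- The points of the open unit cube whose entries are ordered like the values of `σ`. -/
def orderRegion {M : ℕ} (σ : Equiv.Perm (Fin M)) : Set (Fin M → ℝ) :=
  {s | (∀ i, s i ∈ Set.Ioo (0 : ℝ) 1) ∧ ∀ i j, s i < s j ↔ σ i < σ j}

theorem measurableSet_orderRegion {M : ℕ} (σ : Equiv.Perm (Fin M)) :
    MeasurableSet (orderRegion σ) := by
  have : orderRegion σ = (⋂ i, (fun s : Fin M → ℝ => s i) ⁻¹' Set.Ioo 0 1) ∩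
      ⋂ i, ⋂ j, {s : Fin M → ℝ | s i < s j ↔ σ i < σ j} := by
    ext s
    simp [orderRegion]
  rw [this]
  refine (MeasurableSet.iInter fun i => measurable_pi_apply i measurableSet_Ioo).inter
    (MeasurableSet.iInter fun i => MeasurableSet.iInter fun j => ?_)
  by_cases h : σ i < σ j
  · simpa [h] using measurableSet_lt (measurable_pi_apply i) (measurable_pi_apply j)
  · simpa [h] using measurableSet_le (measurable_pi_apply j) (measurable_pi_apply i)

theorem eq_of_mem_orderRegion {M : ℕ} {σ τ : Equiv.Perm (Fin M)} {s : Fin M → ℝ}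
    (hσ : s ∈ orderRegion σ) (hτ : s ∈ orderRegion τ) : σ = τ := by
  have hmono : StrictMono (τ ∘ σ.symm) := fun i j hij => by
    rw [Function.comp_apply, Function.comp_apply, ← hτ.2, hσ.2]
    simpa using hij
  have h := (hmono.range_inj strictMono_id).1 (by
    rw [(τ.surjective.comp σ.symm.surjective).range_eq, Set.range_id])
  ext i
  have := congrFun h (σ i)
  simp only [Function.comp_apply, Equiv.symm_apply_apply, id] at this
  rw [this]

theorem exists_mem_orderRegion {M : ℕ} {s : Fin M → ℝ} (h01 : ∀ i, s i ∈ Set.Ioo (0 : ℝ) 1)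
    (hs : Function.Injective s) : ∃ σ, s ∈ orderRegion σ := by
  have hmono : StrictMono (s ∘ Tuple.sort s) :=
    (Tuple.monotone_sort s).strictMono_of_injective (hs.comp (Tuple.sort s).injective)
  -- `Tuple.sort` sends ranks to positions, whereas `orderRegion` needs positions sent to ranks.
  refine ⟨(Tuple.sort s).symm, h01, fun i j => ?_⟩
  have h := hmono.lt_iff_lt (a := (Tuple.sort s).symm i) (b := (Tuple.sort s).symm j)
  simpa using h

theorem volume_orderRegion_eq {M : ℕ} (σ : Equiv.Perm (Fin M)) :
    MeasureTheory.volume (orderRegion σ)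
      = MeasureTheory.volume (orderRegion (1 : Equiv.Perm (Fin M))) := by
  have hmp := MeasureTheory.volume_measurePreserving_piCongrLeft (fun _ : Fin M => ℝ) σ
  rw [← hmp.measure_preimage_equiv (orderRegion 1)]
  congr 1
  ext s
  have h (i : Fin M) : MeasurableEquiv.piCongrLeft (fun _ : Fin M => ℝ) σ s i = s (σ.symm i) := by
    conv_lhs => rw [← σ.apply_symm_apply i]
    exact Equiv.piCongrLeft_apply_apply (fun _ : Fin M => ℝ) σ s (σ.symm i)
  simp only [orderRegion, Set.mem_preimage, Set.mem_ofPred_eq, h, Equiv.Perm.coe_one, id]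
  refine and_congr ⟨fun H i => H _, fun H i => by simpa using H (σ i)⟩
    ⟨fun H i j => by simpa using H (σ.symm i) (σ.symm j), fun H i j => ?_⟩
  simpa using H (σ i) (σ j)

/-- The `M!` regions are disjoint, fill the unit cube up to a null set, and are carried to one
another by permuting coordinates. -/
theorem volume_orderRegion {M : ℕ} (σ : Equiv.Perm (Fin M)) :
    MeasureTheory.volume (orderRegion σ) = (M.factorial : ENNReal)⁻¹ := by
  rw [volume_orderRegion_eq]
  have hcube : MeasureTheory.volume (Set.pi Set.univ fun _ : Fin M => Set.Ioo (0 : ℝ) 1) = 1 := by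
    rw [Real.volume_pi_Ioo]
    simp
  have hae : (Set.pi Set.univ fun _ : Fin M => Set.Ioo (0 : ℝ) 1) =ᵐ[MeasureTheory.volume]
      ⋃ σ ∈ (Finset.univ : Finset (Equiv.Perm (Fin M))), orderRegion σ := by
    refine Filter.eventuallyEq_set.2 ((ae_isGeneric M).mono fun s hs => ?_)
    simp only [Set.mem_univ_pi, Finset.mem_univ, Set.iUnion_true, Set.mem_iUnion]
    refine ⟨fun h => exists_mem_orderRegion h fun i j hij => ?_, fun ⟨σ, h⟩ => h.1⟩
    by_contra hne
    exact hs.2 i j hne 0 (by simp [hij])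
  have hsum := MeasureTheory.measure_biUnion_finset
    (μ := MeasureTheory.volume) (s := (Finset.univ : Finset (Equiv.Perm (Fin M))))
    (f := orderRegion)
    (fun σ _ τ _ hne => Set.disjoint_left.2 fun s h1 h2 => hne (eq_of_mem_orderRegion h1 h2))
    (fun σ _ => measurableSet_orderRegion σ)
  rw [← MeasureTheory.measure_congr hae, hcube,
    Finset.sum_congr rfl (fun σ _ => volume_orderRegion_eq σ), Finset.sum_const,
    Finset.card_univ, Fintype.card_perm, Fintype.card_fin, nsmul_eq_mul] at hsum
  exact ENNReal.eq_inv_of_mul_eq_one_left (by rw [mul_comm]; exact hsum.symm)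

/-! ### Stanley's dissection of the hypersimplex. -/

/-- The number of descents of `σ` at positions below `m`. -/
def descentsBelow {M : ℕ} (σ : Equiv.Perm (Fin M)) (m : ℕ) : ℕ :=
  (Finset.univ.filter (fun i : Fin M =>
    i.val < m ∧ ∃ h : i.val + 1 < M, σ ⟨i.val + 1, h⟩ < σ i)).card

theorem descentsBelow_zero {M : ℕ} (σ : Equiv.Perm (Fin M)) : descentsBelow σ 0 = 0 := by
  simp [descentsBelow]

theorem descentsBelow_succ {M : ℕ} (σ : Equiv.Perm (Fin M)) {m : ℕ} (hm : m + 1 < M) :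
    descentsBelow σ (m + 1) = descentsBelow σ m
      + if σ ⟨m + 1, hm⟩ < σ ⟨m, Nat.lt_of_succ_lt hm⟩ then 1 else 0 := by
  have hm' : m < M := Nat.lt_of_succ_lt hm
  unfold descentsBelow
  split_ifs with h
  · rw [← Finset.card_insert_of_notMem (a := (⟨m, hm'⟩ : Fin M)) (by simp)]
    congr 1
    ext i
    simp only [Finset.mem_filter, Finset.mem_univ, true_and, Finset.mem_insert]
    constructor
    · rintro ⟨h1, h2⟩
      rcases Nat.lt_succ_iff_lt_or_eq.1 h1 with h3 | h3
      · exact Or.inr ⟨h3, h2⟩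
      · exact Or.inl (Fin.ext h3)
    · rintro (rfl | ⟨h1, h2⟩)
      · exact ⟨Nat.lt_succ_self m, hm, h⟩
      · exact ⟨by omega, h2⟩
  · rw [add_zero]
    congr 1
    ext i
    simp only [Finset.mem_filter, Finset.mem_univ, true_and]
    constructor
    · rintro ⟨h1, h2⟩
      rcases Nat.lt_succ_iff_lt_or_eq.1 h1 with h3 | h3
      · exact ⟨h3, h2⟩
      · obtain rfl : i = ⟨m, hm'⟩ := Fin.ext h3
        exact absurd h2.2 h
    · rintro ⟨h1, h2⟩
      exact ⟨by omega, h2⟩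

theorem descentsBelow_last {m : ℕ} (σ : Equiv.Perm (Fin (m + 1))) :
    descentsBelow σ m = numDescents σ := by
  unfold descentsBelow numDescents
  congr 1
  ext i
  simp only [Finset.mem_filter, Finset.mem_univ, true_and, and_iff_right_iff_imp]
  rintro ⟨h, -⟩
  omega

theorem hyperplaneMap_mem_hypersimplex_iff {m k : ℕ} (s : Fin (m + 1) → ℝ) :
    hyperplaneMap k s ∈ hypersimplex (m + 2) k ↔ s 0 ∈ Set.Icc (0 : ℝ) 1 ∧
      (∀ i : Fin m, s i.succ - s i.castSucc ∈ Set.Icc (0 : ℝ) 1) ∧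
      k - s (Fin.last m) ∈ Set.Icc (0 : ℝ) 1 := by
  have h0 : hyperplaneMap (k : ℝ) s 0 = s 0 := by
    have h1 : (0 : Fin (m + 2)) = Fin.castSucc 0 := rfl
    rw [hyperplaneMap, Pi.add_apply, diffMap_apply, Fin.cons_zero, h1, Fin.snoc_castSucc,
      Pi.single_eq_of_ne (Fin.castSucc_lt_last _).ne]
    simp
  have hi (i : Fin m) : hyperplaneMap (k : ℝ) s i.castSucc.succ = s i.succ - s i.castSucc := by
    rw [hyperplaneMap, Pi.add_apply, diffMap_apply, Fin.cons_succ, Fin.succ_castSucc,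
      Fin.snoc_castSucc, Pi.single_eq_of_ne (Fin.castSucc_lt_last _).ne]
    simp
  have hl : hyperplaneMap (k : ℝ) s (Fin.last (m + 1)) = k - s (Fin.last m) := by
    rw [hyperplaneMap, Pi.add_apply, diffMap_apply, Fin.snoc_last, ← Fin.succ_last, Fin.cons_succ]
    simp
    ring
  constructor
  · rintro ⟨h, -⟩
    exact ⟨h0 ▸ h 0, fun i => hi i ▸ h _, hl ▸ h _⟩
  · rintro ⟨h1, h2, h3⟩
    refine ⟨fun i => ?_, sum_hyperplaneMap _ _⟩
    refine Fin.cases (h0.symm ▸ h1) (fun i => ?_) i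
    refine Fin.lastCases ?_ (fun i => ?_) i
    · rw [Fin.succ_last, hl]; exact h3
    · rw [hi]; exact h2 i

/-- The translate of `orderRegion σ` on which consecutive entries differ by at most one. -/
def shiftedOrderRegion {M : ℕ} (σ : Equiv.Perm (Fin M)) : Set (Fin M → ℝ) :=
  {s | s - (fun i => (descentsBelow σ i.val : ℝ)) ∈ orderRegion σ}

theorem fract_mem_orderRegion {M : ℕ} {σ : Equiv.Perm (Fin M)} {s : Fin M → ℝ}
    (hs : s ∈ shiftedOrderRegion σ) : (fun i => Int.fract (s i)) ∈ orderRegion σ := by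
  have : (fun i => Int.fract (s i)) = s - (fun i => (descentsBelow σ i.val : ℝ)) := by
    ext i
    have h := hs.1 i
    rw [← Int.fract_sub_natCast (s i) (descentsBelow σ i.val)]
    exact Int.fract_eq_self.2 ⟨h.1.le, h.2⟩
  rw [this]
  exact hs

/-- At a descent the fractional part drops by less than 1 and the shift adds 1; elsewhere it rises
by less than 1. The last entry is 1 minus the last fractional part. -/
theorem hyperplaneMap_mem_of_mem_shiftedOrderRegion {m k : ℕ} {σ : Equiv.Perm (Fin (m + 1))}
    (hσ : numDescents σ + 1 = k) {s : Fin (m + 1) → ℝ} (hs : s ∈ shiftedOrderRegion σ) :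
    hyperplaneMap k s ∈ hypersimplex (m + 2) k := by
  obtain ⟨h01, hord⟩ := hs
  simp only [Pi.sub_apply] at h01 hord
  rw [hyperplaneMap_mem_hypersimplex_iff]
  refine ⟨?_, fun i => ?_, ?_⟩
  · have := h01 0
    rw [Fin.val_zero, descentsBelow_zero] at this
    simp only [Nat.cast_zero, sub_zero] at this
    exact ⟨this.1.le, this.2.le⟩
  · have h1 := h01 i.succ
    have h2 := h01 i.castSucc
    have h3 := hord i.succ i.castSucc
    have h4 := descentsBelow_succ σ (m := i.val) (by omega)
    simp only [Fin.val_succ, Fin.val_castSucc, Set.mem_Ioo] at h1 h2 h3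
    rw [h4] at h1 h3
    change _ ↔ σ ⟨i.val + 1, _⟩ < σ ⟨i.val, _⟩ at h3
    split_ifs at h1 h3 with h5
    · have := h3.2 h5
      push_cast at h1 this
      constructor <;> linarith
    · have := not_lt.1 (mt h3.1 h5)
      push_cast at h1 this
      constructor <;> linarith
  · have h1 := h01 (Fin.last m)
    rw [Fin.val_last, descentsBelow_last] at h1
    rw [← hσ]
    push_cast
    constructor <;> linarith [h1.1, h1.2]

/-- Take `σ` to be the order of the fractional parts. Consecutive differences in `[0, 1]` force the
floor to rise by exactly 1 at descents and to stay put elsewhere, so floors count descents. -/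
theorem exists_mem_shiftedOrderRegion {m k : ℕ} {s : Fin (m + 1) → ℝ} (hs : IsGeneric s)
    (h : hyperplaneMap k s ∈ hypersimplex (m + 2) k) :
    ∃ σ : Equiv.Perm (Fin (m + 1)), numDescents σ + 1 = k ∧ s ∈ shiftedOrderRegion σ := by
  have hpos (i : Fin (m + 1)) : 0 < Int.fract (s i) :=
    Int.fract_pos.2 (hs.1 i _)
  have hinj : Function.Injective fun i => Int.fract (s i) := fun i j hij => by
    by_contra hne
    refine hs.2 i j hne (⌊s i⌋ - ⌊s j⌋) ?_
    have h1 := Int.floor_add_fract (s i)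
    have h2 := Int.floor_add_fract (s j)
    simp only at hij
    push_cast
    linarith
  obtain ⟨σ, hσ⟩ := exists_mem_orderRegion (fun i => ⟨hpos i, Int.fract_lt_one _⟩) hinj
  obtain ⟨h0, hi, hl⟩ := (hyperplaneMap_mem_hypersimplex_iff s).1 h
  have hfloor : ∀ l (hlt : l < m + 1), ⌊s ⟨l, hlt⟩⌋ = descentsBelow σ l := by
    intro l
    induction l with
    | zero =>
      intro hlt
      rw [descentsBelow_zero, Nat.cast_zero, Int.floor_eq_zero_iff]
      refine ⟨h0.1, lt_of_le_of_ne h0.2 ?_⟩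
      simpa using hs.1 0 1
    | succ l ih =>
      intro hlt
      have h1 := ih (by omega)
      have h2 := hi ⟨l, by omega⟩
      have h3 := hσ.2 ⟨l + 1, hlt⟩ ⟨l, by omega⟩
      have h4 := descentsBelow_succ σ hlt
      have h5 : s ⟨l + 1, hlt⟩ - s ⟨l, by omega⟩ ∈ Set.Icc (0 : ℝ) 1 := h2
      have e1 := Int.floor_add_fract (s ⟨l + 1, hlt⟩)
      have e2 := Int.floor_add_fract (s ⟨l, by omega⟩)
      have f1 := Int.fract_lt_one (s ⟨l + 1, hlt⟩)
      have f2 := Int.fract_lt_one (s ⟨l, by omega⟩)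
      have p1 := hpos ⟨l + 1, hlt⟩
      have p2 := hpos ⟨l, by omega⟩
      have hne : Int.fract (s ⟨l + 1, hlt⟩) ≠ Int.fract (s ⟨l, by omega⟩) := fun h => by
        simpa using hinj h
      rw [h4, ← sub_eq_zero]
      push_cast
      rw [← h1]
      simp only at h3
      split_ifs with hd
      · have h6 := h3.2 hd
        have u1 : ((⌊s ⟨l + 1, hlt⟩⌋ - ⌊s ⟨l, by omega⟩⌋ : ℤ) : ℝ) < 2 := by
          push_cast; linarith [h5.2]
        have u2 : (0 : ℝ) < ((⌊s ⟨l + 1, hlt⟩⌋ - ⌊s ⟨l, by omega⟩⌋ : ℤ) : ℝ) := by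
          push_cast; linarith [h5.1]
        have u1 : ⌊s ⟨l + 1, hlt⟩⌋ - ⌊s ⟨l, by omega⟩⌋ < 2 := by exact_mod_cast u1
        have u2 : 0 < ⌊s ⟨l + 1, hlt⟩⌋ - ⌊s ⟨l, by omega⟩⌋ := by exact_mod_cast u2
        omega
      · have h6 := lt_of_le_of_ne (not_lt.1 (mt h3.1 hd)) hne.symm
        have u1 : ((⌊s ⟨l + 1, hlt⟩⌋ - ⌊s ⟨l, by omega⟩⌋ : ℤ) : ℝ) < 1 := by
          push_cast; linarith [h5.2]
        have u2 : (-1 : ℝ) < ((⌊s ⟨l + 1, hlt⟩⌋ - ⌊s ⟨l, by omega⟩⌋ : ℤ) : ℝ) := by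
          push_cast; linarith [h5.1]
        have u1 : ⌊s ⟨l + 1, hlt⟩⌋ - ⌊s ⟨l, by omega⟩⌋ < 1 := by exact_mod_cast u1
        have u2 : -1 < ⌊s ⟨l + 1, hlt⟩⌋ - ⌊s ⟨l, by omega⟩⌋ := by exact_mod_cast u2
        omega
  refine ⟨σ, ?_, ?_⟩
  · have h1 := hfloor m (by omega)
    rw [descentsBelow_last] at h1
    have h2 : (k : ℝ) - s ⟨m, by omega⟩ ∈ Set.Icc (0 : ℝ) 1 := hl
    have e1 := Int.floor_add_fract (s ⟨m, by omega⟩)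
    have f1 := Int.fract_lt_one (s ⟨m, by omega⟩)
    have p1 := hpos ⟨m, by omega⟩
    rw [h1] at e1
    -- The last partial sum lies strictly between `numDescents σ` and `numDescents σ + 1`, and `k`
    -- exceeds it by at most 1.
    have u1 : (k : ℝ) < (numDescents σ + 2 : ℕ) := by push_cast at e1 ⊢; linarith [h2.2]
    have u2 : (numDescents σ : ℝ) < k := by push_cast at e1 ⊢; linarith [h2.1]
    rw [Nat.cast_lt] at u1 u2
    omega
  · have : s - (fun i => (descentsBelow σ i.val : ℝ)) = fun i => Int.fract (s i) := by
      ext i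
      have := hfloor i.val i.isLt
      have e := Int.floor_add_fract (s i)
      rw [show ⌊s i⌋ = (descentsBelow σ i.val : ℤ) from this] at e
      push_cast at e
      simp only [Pi.sub_apply]
      linarith
    change _ ∈ orderRegion σ
    rw [this]
    exact hσ

/-- The shifted regions are disjoint because the fractional parts of a point determine its
permutation. -/
theorem volume_hypersimplex (m k : ℕ) :
    MeasureTheory.volume (hyperplaneMap (M := m + 1) (k : ℝ) ⁻¹' hypersimplex (m + 2) k)
      = eulerianNumber (m + 1) k / ((m + 1).factorial : ENNReal) := by
  have hae : (hyperplaneMap (M := m + 1) (k : ℝ) ⁻¹' hypersimplex (m + 2) k)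
      =ᵐ[MeasureTheory.volume]
      ⋃ σ ∈ Finset.univ.filter (fun σ : Equiv.Perm (Fin (m + 1)) => numDescents σ + 1 = k),
        shiftedOrderRegion σ := by
    refine Filter.eventuallyEq_set.2 ((ae_isGeneric (m + 1)).mono fun s hs => ?_)
    simp only [Set.mem_preimage, Finset.mem_filter, Finset.mem_univ, true_and, Set.mem_iUnion,
      exists_prop]
    exact ⟨exists_mem_shiftedOrderRegion hs,
      fun ⟨σ, h1, h2⟩ => hyperplaneMap_mem_of_mem_shiftedOrderRegion h1 h2⟩
  have hvol (σ : Equiv.Perm (Fin (m + 1))) : MeasureTheory.volume (shiftedOrderRegion σ)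
      = ((m + 1).factorial : ENNReal)⁻¹ := by
    rw [← volume_orderRegion σ]
    have hsub (s c : Fin (m + 1) → ℝ) : s - c = s + -c := sub_eq_add_neg s c
    simp only [shiftedOrderRegion, hsub]
    exact MeasureTheory.measure_preimage_add_right _ _ _
  rw [MeasureTheory.measure_congr hae, MeasureTheory.measure_biUnion_finset
    (fun σ _ τ _ hne => Set.disjoint_left.2 fun s h1 h2 =>
      hne (eq_of_mem_orderRegion (fract_mem_orderRegion h1) (fract_mem_orderRegion h2)))
    (fun σ _ => (measurable_id.sub_const _) (measurableSet_orderRegion σ)),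
    Finset.sum_congr rfl (fun σ _ => hvol σ), Finset.sum_const, nsmul_eq_mul, div_eq_mul_inv]
  rfl

/-! ### Cycle lemma for rotations by blocks. -/

theorem prefixSum_hyperplaneMap {M : ℕ} (k : ℝ) (s : Fin M → ℝ) (m : ℕ) (hm : m < M + 1) :
    prefixSum (hyperplaneMap k s) m = Fin.cons (α := fun _ => ℝ) 0 s ⟨m, hm⟩ := by
  induction m with
  | zero => rw [prefixSum_zero]; rfl
  | succ m ih =>
    have h1 : Fin.ofNat (M + 1) m = Fin.castSucc ⟨m, by omega⟩ :=
      Fin.ext (Nat.mod_eq_of_lt (by omega))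
    have h2 : (⟨m, by omega⟩ : Fin (M + 1)) = Fin.castSucc ⟨m, by omega⟩ := rfl
    have h3 : (⟨m + 1, hm⟩ : Fin (M + 1)) = Fin.succ ⟨m, by omega⟩ := rfl
    rw [prefixSum_succ, ih (by omega), h1, h2, h3, hyperplaneMap, Pi.add_apply, diffMap_apply,
      Fin.cons_succ, Fin.snoc_castSucc, Pi.single_eq_of_ne (Fin.castSucc_lt_last _).ne]
    ring

theorem prefixSum_rotate {N : ℕ} [NeZero N] (x : Fin N → ℝ) (c m : ℕ) :
    prefixSum (x ∘ Equiv.addRight (Fin.ofNat N c)) m = prefixSum x (c + m) - prefixSum x c := by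
  rw [prefixSum, prefixSum, prefixSum, Finset.sum_range_add, add_sub_cancel_left]
  refine Finset.sum_congr rfl fun i _ => congrArg x ?_
  ext
  simp [Fin.val_add, add_comm]

theorem comp_mem_hypersimplex_iff {N k : ℕ} {x : Fin N → ℝ} (σ : Equiv.Perm (Fin N)) :
    x ∘ σ ∈ hypersimplex N k ↔ x ∈ hypersimplex N k := by
  refine and_congr ⟨fun h i => by simpa using h (σ.symm i), fun h i => h _⟩ ?_
  rw [← Equiv.sum_comp σ x]
  rfl

/-- The condition says that the excess at `i` is minimal among all later ones, hence, by periodicity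
when `N = n * d` and `k = n * b`, among all. -/
theorem rotate_mem_catalanRegion_iff {N k d b : ℕ} [NeZero N] {x : Fin N → ℝ} (i : ℕ) :
    x ∘ Equiv.addRight (Fin.ofNat N (i * d)) ∈ catalanRegion N k d b ↔ x ∈ hypersimplex N k ∧
      ∀ j : ℕ, prefixSum x (i * d) - i * b ≤ prefixSum x ((i + j) * d) - (i + j : ℕ) * b := by
  refine and_congr (comp_mem_hypersimplex_iff _) (forall_congr' fun j => ?_)
  rw [prefixSum_rotate, ← add_mul]
  push_cast
  constructor <;> intro h <;> linarith

theorem prefixSum_block_mod {N n d b : ℕ} [NeZero N] (hN : N = n * d) {x : Fin N → ℝ}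
    (hx : ∑ i, x i = (n * b : ℕ)) (j : ℕ) :
    prefixSum x (j * d) - j * b = prefixSum x (j % n * d) - (j % n : ℕ) * b := by
  have h := prefixSum_block_period hN hx (j % n) (j / n)
  rwa [mul_comm (j / n) n, Nat.mod_add_div] at h

/-- A cyclic shift by blocks moves every point of the hypersimplex into the region. -/
theorem exists_rotate_mem_catalanRegion {N n d b : ℕ} [NeZero N] (hn : 0 < n) (hN : N = n * d)
    {x : Fin N → ℝ} (hx : x ∈ hypersimplex N (n * b)) :
    ∃ i < n, x ∘ Equiv.addRight (Fin.ofNat N (i * d)) ∈ catalanRegion N (n * b) d b := by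
  -- Start at the block where the excess is least; a minimum over one period is a global one.
  obtain ⟨i, hi, hmin⟩ := Finset.exists_min_image (Finset.range n)
    (fun j : ℕ => prefixSum x (j * d) - j * b) ⟨0, Finset.mem_range.2 hn⟩
  refine ⟨i, Finset.mem_range.1 hi, (rotate_mem_catalanRegion_iff i).2 ⟨hx, fun j => ?_⟩⟩
  rw [prefixSum_block_mod hN hx.2 (i + j)]
  exact hmin _ (Finset.mem_range.2 (Nat.mod_lt _ hn))

theorem prefixSum_block_eq_of_rotate_mem {N n d b : ℕ} [NeZero N] (hN : N = n * d)
    {x : Fin N → ℝ} {i j : ℕ} (hij : i < j) (hj : j < n)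
    (hi : x ∘ Equiv.addRight (Fin.ofNat N (i * d)) ∈ catalanRegion N (n * b) d b)
    (hjx : x ∘ Equiv.addRight (Fin.ofNat N (j * d)) ∈ catalanRegion N (n * b) d b) :
    prefixSum x (i * d) - i * b = prefixSum x (j * d) - j * b := by
  obtain ⟨hx, h1⟩ := (rotate_mem_catalanRegion_iff i).1 hi
  obtain ⟨-, h2⟩ := (rotate_mem_catalanRegion_iff j).1 hjx
  have h1 := h1 (j - i)
  -- Going `n - j + i` blocks on from `j` reaches `i + n`, where the excess is that at `i`.
  have h2 := h2 (n - j + i)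
  have h3 := prefixSum_block_period hN hx.2 i 1
  rw [show i + (j - i) = j by omega] at h1
  rw [show j + (n - j + i) = i + 1 * n by omega, h3] at h2
  exact le_antisymm h1 h2

theorem continuous_prefixSum {N : ℕ} [NeZero N] (m : ℕ) :
    Continuous fun x : Fin N → ℝ => prefixSum x m := by
  unfold prefixSum
  fun_prop

theorem isClosed_hypersimplex (N k : ℕ) : IsClosed (hypersimplex N k) := by
  have : hypersimplex N k = (⋂ i, {x | x i ∈ Set.Icc (0 : ℝ) 1}) ∩
      {x | ∑ i, x i = (k : ℝ)} := by
    ext x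
    simp [hypersimplex]
  rw [this]
  exact (isClosed_iInter fun i => isClosed_Icc.preimage (continuous_apply i)).inter
    (isClosed_eq (by fun_prop) continuous_const)

theorem isClosed_catalanRegion (N k d b : ℕ) [NeZero N] : IsClosed (catalanRegion N k d b) := by
  have : catalanRegion N k d b
      = hypersimplex N k ∩ ⋂ j : ℕ, {x | (j * b : ℝ) ≤ prefixSum x (j * d)} := by
    ext x
    simp [catalanRegion]
  rw [this]
  exact (isClosed_hypersimplex N k).inter
    (isClosed_iInter fun j => isClosed_le continuous_const (continuous_prefixSum _))

/-- The set `A i` consists of the points whose excess is minimal at `i`. These `n` sets are rotated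
copies of the Catalan region, and two of them meet inside a hyperplane of the partial-sum
coordinates. -/
theorem volume_hypersimplex_eq_mul_volume_catalanRegion {M n d b : ℕ} (hn : 0 < n) (hd : 0 < d)
    (hN : M + 1 = n * d) :
    MeasureTheory.volume (hyperplaneMap ((n * b : ℕ) : ℝ) ⁻¹' hypersimplex (M + 1) (n * b))
      = n * MeasureTheory.volume
        (hyperplaneMap ((n * b : ℕ) : ℝ) ⁻¹' catalanRegion (M + 1) (n * b) d b) := by
  set A : ℕ → Set (Fin (M + 1) → ℝ) := fun i =>
    {x | x ∘ Equiv.addRight (Fin.ofNat (M + 1) (i * d)) ∈ catalanRegion (M + 1) (n * b) d b}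
    with hA
  have hunion : hypersimplex (M + 1) (n * b) = ⋃ i ∈ Finset.range n, A i := by
    ext x
    simp only [Set.mem_iUnion, Finset.mem_range, exists_prop]
    refine ⟨exists_rotate_mem_catalanRegion hn hN, ?_⟩
    rintro ⟨i, -, hi⟩
    exact ((rotate_mem_catalanRegion_iff i).1 hi).1
  have hmeas (i : ℕ) : MeasurableSet (hyperplaneMap ((n * b : ℕ) : ℝ) ⁻¹' A i) := by
    refine IsClosed.measurableSet (IsClosed.preimage (continuous_hyperplaneMap _) ?_)
    exact (isClosed_catalanRegion _ _ _ _).preimage (by fun_prop)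
  have hlt {i : ℕ} (hi : i < n) : i * d < M + 1 := hN ▸ Nat.mul_lt_mul_of_pos_right hi hd
  have hdisj {i j : ℕ} (hij : i < j) (hj : j < n) : MeasureTheory.volume
      (hyperplaneMap ((n * b : ℕ) : ℝ) ⁻¹' A i ∩ hyperplaneMap ((n * b : ℕ) : ℝ) ⁻¹' A j) = 0 := by
    have hne : (⟨i * d, hlt (hij.trans hj)⟩ : Fin (M + 1)) ≠ ⟨j * d, hlt hj⟩ := fun h =>
      (Nat.mul_lt_mul_of_pos_right hij hd).ne (congrArg Fin.val h)
    refine MeasureTheory.measure_mono_null (fun s hs => ?_)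
      (volume_cons_sub_cons_eq hne (i * b - j * b))
    have h := prefixSum_block_eq_of_rotate_mem hN hij hj hs.1 hs.2
    rw [prefixSum_hyperplaneMap _ _ _ (hlt (hij.trans hj)),
      prefixSum_hyperplaneMap _ _ _ (hlt hj)] at h
    simp only [Set.mem_ofPred_eq]
    linarith
  rw [hunion, Set.preimage_iUnion₂, MeasureTheory.measure_biUnion_finset₀ ?_
    (fun i _ => (hmeas i).nullMeasurableSet),
    Finset.sum_congr rfl (fun i _ => volume_hyperplaneMap_preimage_comp _ _ _), Finset.sum_const,
    Finset.card_range, nsmul_eq_mul]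
  intro i hi j hj hij
  have hi := Finset.mem_range.1 hi
  have hj := Finset.mem_range.1 hj
  rcases lt_or_gt_of_ne hij with h | h
  · exact hdisj h hj
  · exact MeasureTheory.AEDisjoint.symm (hdisj h hi)

/-! ### Full-dimensionality and the volume formulas. -/

/-- The points satisfying all non-trivial inequalities of `catalanRegion` strictly. -/
def strictCatalanRegion (N n d b : ℕ) [NeZero N] : Set (Fin N → ℝ) :=
  {x | (∀ i, x i ∈ Set.Ioo (0 : ℝ) 1) ∧
    ∀ j : Fin n, j.val ≠ 0 → (j.val * b : ℝ) < prefixSum x (j.val * d)}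

theorem isOpen_strictCatalanRegion (N n d b : ℕ) [NeZero N] :
    IsOpen (strictCatalanRegion N n d b) := by
  have : strictCatalanRegion N n d b = (⋂ i, {x | x i ∈ Set.Ioo (0 : ℝ) 1}) ∩
      ⋂ j : Fin n, ⋂ _ : j.val ≠ 0, {x | (j.val * b : ℝ) < prefixSum x (j.val * d)} := by
    ext x
    simp [strictCatalanRegion]
  rw [this]
  exact (isOpen_iInter_of_finite fun i => isOpen_Ioo.preimage (continuous_apply i)).inter
    (isOpen_iInter_of_finite fun j => isOpen_iInter_of_finite fun _ =>
      isOpen_lt continuous_const (continuous_prefixSum _))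

theorem mem_catalanRegion_of_strict {N n d b : ℕ} [NeZero N] (hn : 0 < n) (hN : N = n * d)
    {x : Fin N → ℝ} (hx : x ∈ strictCatalanRegion N n d b) (hs : ∑ i, x i = (n * b : ℕ)) :
    x ∈ catalanRegion N (n * b) d b := by
  refine ⟨⟨fun i => Set.Ioo_subset_Icc_self (hx.1 i), hs⟩, fun j => ?_⟩
  have h := prefixSum_block_mod hN hs j
  by_cases h0 : j % n = 0
  · rw [h0] at h
    simp only [zero_mul, prefixSum_zero, Nat.cast_zero, sub_zero] at h
    linarith
  · have := hx.2 ⟨j % n, Nat.mod_lt _ hn⟩ h0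
    simp only at this
    linarith

/-- The constant point `b / d` meets every block bound with equality. Moving `ε` from the last entry
to the first lifts all intermediate prefix sums by `ε`. -/
theorem exists_mem_strictCatalanRegion {M n d b : ℕ} (hb : 0 < b) (hbd : b < d)
    (hN : M + 1 = n * d) :
    ∃ p ∈ strictCatalanRegion (M + 1) n d b, ∑ i, p i = (n * b : ℕ) := by
  have hd : (0 : ℝ) < d := by exact_mod_cast hb.trans hbd
  obtain ⟨c, hc⟩ : ∃ c : ℝ, c = b / d := ⟨_, rfl⟩
  have hcd : d * c = b := by rw [hc]; field_simp
  have hc0 : 0 < c := by rw [hc]; positivity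
  have hc1 : c < 1 := by
    rw [hc, div_lt_one hd]
    exact_mod_cast hbd
  obtain ⟨ε, hε0, hε1, hε2⟩ : ∃ ε : ℝ, 0 < ε ∧ ε < c ∧ ε < 1 - c := by
    obtain ⟨ε, h1, h2⟩ := exists_between (lt_min hc0 (sub_pos.2 hc1))
    exact ⟨ε, h1, h2.trans_le (min_le_left _ _), h2.trans_le (min_le_right _ _)⟩
  -- partial sums `(m + 1) * c + ε`
  set s : Fin M → ℝ := fun i => (i.val + 1) * c + ε with hs
  have hval (i : Fin (M + 1)) : hyperplaneMap ((n * b : ℕ) : ℝ) s i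
      = c + (if i.val = 0 then ε else 0) - (if i.val = M then ε else 0) := by
    have hM : ((M : ℝ) + 1) * c = n * b := by
      have : ((M + 1 : ℕ) : ℝ) = (n * d : ℕ) := congrArg _ hN
      push_cast at this
      rw [this, mul_assoc, hcd]
    have h1 : Fin.snoc (α := fun _ => ℝ) s 0 i + (Pi.single (Fin.last M) (n * b : ℝ) :
        Fin (M + 1) → ℝ) i = (i.val + 1) * c + ε - (if i.val = M then ε else 0) := by
      refine Fin.lastCases ?_ (fun i => ?_) i
      · simp [← hM]
      · simp [hs, i.isLt.ne]
    have h2 : Fin.cons (α := fun _ => ℝ) 0 s i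
        = i.val * c + ε - (if i.val = 0 then ε else 0) := by
      refine Fin.cases ?_ (fun i => ?_) i
      · simp
      · simp [hs]
    rw [hyperplaneMap, Pi.add_apply, diffMap_apply, h2]
    push_cast
    linarith
  -- The first and last entries must be different for the move of `ε`.
  have hM0 : M ≠ 0 := by
    rintro rfl
    have : d ∣ 1 := ⟨n, by rw [mul_comm]; exact hN⟩
    have := Nat.le_of_dvd one_pos this
    omega
  refine ⟨hyperplaneMap ((n * b : ℕ) : ℝ) s, ⟨fun i => ?_, fun j hj => ?_⟩,
    sum_hyperplaneMap _ _⟩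
  · rw [hval]
    split_ifs with h1 h2
    · omega
    all_goals constructor <;> linarith
  · have hlt : j.val * d < M + 1 :=
      hN ▸ Nat.mul_lt_mul_of_pos_right j.isLt (hb.trans hbd)
    obtain ⟨m, hm⟩ := Nat.exists_eq_succ_of_ne_zero
      (Nat.mul_ne_zero hj (hb.trans hbd).ne')
    have h3 : (⟨j.val * d, hlt⟩ : Fin (M + 1)) = Fin.succ ⟨m, by omega⟩ := Fin.ext hm
    rw [prefixSum_hyperplaneMap _ _ _ hlt, h3, Fin.cons_succ]
    have h4 : ((m : ℝ) + 1) = j.val * d := by exact_mod_cast hm.symm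
    simp only [hs]
    rw [h4, mul_assoc, hcd]
    linarith

theorem latticeVolume_hypersimplex_and_catalanRegion {N n d b : ℕ} [NeZero N] (hn : 0 < n)
    (hb : 0 < b) (hbd : b < d) (hN : N = n * d) :
    latticeVolume (hypersimplex N (n * b))
        = eulerianNumber (N - 1) (n * b) / ((N - 1).factorial : ENNReal) ∧
      latticeVolume (hypersimplex N (n * b)) = n * latticeVolume (catalanRegion N (n * b) d b) := by
  obtain ⟨m, rfl⟩ : ∃ m, N = m + 2 := by
    refine ⟨N - 2, ?_⟩
    have : 2 ≤ N := by
      rw [hN]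
      calc 2 ≤ d := by omega
        _ ≤ n * d := Nat.le_mul_of_pos_left d hn
    omega
  obtain ⟨p, hp, hps⟩ := exists_mem_strictCatalanRegion hb hbd hN
  -- One open set serves both polytopes, since the Catalan region lies in the hypersimplex.
  have hU := isOpen_strictCatalanRegion (m + 2) n d b
  have hmem : ∀ x ∈ strictCatalanRegion (m + 2) n d b, ∑ i, x i = (n * b : ℕ) →
      x ∈ catalanRegion (m + 2) (n * b) d b := fun x hx hs => mem_catalanRegion_of_strict hn hN hx hs
  have h1 : latticeVolume (hypersimplex (m + 2) (n * b)) = _ :=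
    latticeVolume_eq_volume_hyperplaneMap ⟨p, (hmem p hp hps).1⟩ (fun x hx => hx.2)
      (mem_vectorSpan_iff_sum_eq_zero (fun x hx => hx.2) hU
        (fun x hx hs => (hmem x hx hs).1) hp hps)
  have h2 : latticeVolume (catalanRegion (m + 2) (n * b) d b) = _ :=
    latticeVolume_eq_volume_hyperplaneMap ⟨p, hmem p hp hps⟩ (fun x hx => hx.1.2)
      (mem_vectorSpan_iff_sum_eq_zero (fun x hx => hx.1.2) hU hmem hp hps)
  refine ⟨h1.trans (volume_hypersimplex m (n * b)), ?_⟩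
  rw [h1, h2]
  exact volume_hypersimplex_eq_mul_volume_catalanRegion hn (hb.trans hbd) hN

theorem corollary4p2 (a b n : ℕ) (ha : 1 ≤ a) (hb : 1 ≤ b) (hn : 1 ≤ n) :
    latticeVolume (matroidPolytope (catalanMatroid a b n))
        = ENNReal.ofReal ((eulerianNumber (n * (a + b) - 1) (n * b) : ℝ)
            / ((n : ℝ) * ((n * (a + b) - 1).factorial : ℝ))) ∧
      latticeVolume (matroidPolytope (catalanMatroid a b n))
        = latticeVolume (matroidPolytope (uniformMatroid (n * b) (n * (a + b))
            (Nat.mul_le_mul_left n (Nat.le_add_left b a)))) / (n : ENNReal) := by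
  have : NeZero (n * (a + b)) := ⟨Nat.mul_ne_zero (by omega) (by omega)⟩
  have hn0 : (n : ENNReal) ≠ 0 := by exact_mod_cast (show n ≠ 0 by omega)
  obtain ⟨h1, h2⟩ := latticeVolume_hypersimplex_and_catalanRegion (N := n * (a + b)) (n := n)
    (d := a + b) (b := b) hn hb (by omega) rfl
  rw [matroidPolytope_catalanMatroid, matroidPolytope_uniformMatroid]
  have h3 : latticeVolume (catalanRegion (n * (a + b)) (n * b) (a + b) b)
      = latticeVolume (hypersimplex (n * (a + b)) (n * b)) / n := by
    exact (ENNReal.eq_div_iff hn0 (ENNReal.natCast_ne_top n)).2 h2.symm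
  refine ⟨?_, h3⟩
  have hpos : (0 : ℝ) < n * ((n * (a + b) - 1).factorial : ℝ) :=
    mul_pos (by exact_mod_cast hn) (by exact_mod_cast Nat.factorial_pos _)
  rw [h3, h1, ENNReal.ofReal_div_of_pos hpos, ENNReal.ofReal_mul (by positivity),
    ENNReal.ofReal_natCast, ENNReal.ofReal_natCast, ENNReal.ofReal_natCast, div_eq_mul_inv,
    div_eq_mul_inv, div_eq_mul_inv, ENNReal.mul_inv (Or.inl hn0)
    (Or.inl (ENNReal.natCast_ne_top n)), mul_assoc, mul_comm (n : ENNReal)⁻¹]
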